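/- Let $\sigma$ be the surface measure on the unit sphere $\mathbb{S}^2\subset\mathbb{R}^3$ ($\sigma(\mathbb{S}^2)=4\pi$). For each $\ell\ge 0$ let $Y_{\ell,m}$, $m=-\ell,\dots,\ell$, be an orthonormal basis, in $L_2(\mathbb{S}^2,\sigma)$, of the space of restrictions to $\mathbb{S}^2$ of the complex homogeneous harmonic polynomials of degree $\ell$ in three variables. Let $(\Omega,\mathcal{F},P)$ be a probability space, let $(\beta_\ell)_{\ell\ge 0}$ be a sequence of positive reals and let $\lambda\ge 0$. A real random field is a jointly measurable function $T:\Omega\times\mathbb{S}^2\to\mathbb{R}$ with $T\in L_2(\Omega\times\mathbb{S}^2,P\otimes\sigma)$; it is called strongly isotropic if for all $k\in\mathbb{N}$, all $x_1,\dots,x_k\in\mathbb{S}^2$ and all rotations $\rho\in SO(3)$ the random vectors $(T(x_1),\dots,T(x_k))$ and $(T(\rho x_1),\dots,T(\rho x_k))$ have the same law. Let $T^o$ be a real random field (the observed field), with Fourier coefficients $a^o_{\ell,m}=\int_{\mathbb{S}^2}T^o(x)\overline{Y_{\ell,m}(x)}\,d\sigma(x)$, and put $A^o_\ell=\big(\sum_{m=-\ell}^{\ell}|a^o_{\ell,m}|^2\big)^{1/2}$.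 Define the regularized coefficients by $$a^r_{\ell,m}=\Big(1-\frac{\lambda\beta_\ell}{A^o_\ell}\Big)a^o_{\ell,m}\ \text{ if } A^o_\ell>\lambda\beta_\ell,\qquad a^r_{\ell,m}=0\ \text{ if } A^o_\ell\le\lambda\beta_\ell .$$ A regularized field of $T^o$ is a real random field $T^r$ with $$T^r=\sum_{\ell=0}^{\infty}\sum_{m=-\ell}^{\ell}a^r_{\ell,m}Y_{\ell,m},$$ where the series over $\ell$ converges to $T^r$ in $L_2(\Omega\times\mathbb{S}^2)$ and, for every single point $x\in\mathbb{S}^2$, its value at $x$ converges to $T^r(x)$ in $L_2(\Omega)$. If $T^o$ is strongly isotropic, then a regularized field $T^r$ of $T^o$ exists, and every regularized field $T^r$ of $T^o$ is strongly isotropic. -/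

import Mathlib

open MeasureTheory ProbabilityTheory Filter Topology
open scoped ENNReal ComplexConjugate

noncomputable section

namespace SphereField

/-- Three-dimensional Euclidean space. -/
abbrev E3 : Type := EuclideanSpace ℝ (Fin 3)

/-- The unit sphere of three-dimensional Euclidean space. -/
abbrev S2 : Type := Metric.sphere (0 : E3) 1

/-- The surface measure on the sphere (of total mass `4 * π`). -/
def surf : Measure S2 := (volume : Measure E3).toSphere

/-- A rotation: a linear isometry of Euclidean space of determinant one. -/
def IsRotation (ρ : E3 ≃ₗᵢ[ℝ] E3) : Prop :=
  LinearMap.det (ρ.toLinearEquiv : E3 →ₗ[ℝ] E3) = 1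

/-- The action of a linear isometry on the points of the sphere. -/
def rotate (ρ : E3 ≃ₗᵢ[ℝ] E3) (x : S2) : S2 :=
  ⟨ρ (x : E3), by simp⟩

/-- The restriction to the sphere of a complex polynomial in three variables. -/
def restrictPoly (p : MvPolynomial (Fin 3) ℂ) (x : S2) : ℂ :=
  MvPolynomial.eval (fun i => (((x : E3) i : ℝ) : ℂ)) p

/-- The Laplacian of a polynomial in three variables, as a linear map. -/
def laplacian : MvPolynomial (Fin 3) ℂ →ₗ[ℂ] MvPolynomial (Fin 3) ℂ :=
  ∑ i : Fin 3, (MvPolynomial.pderiv i).toLinearMap ∘ₗ (MvPolynomial.pderiv i).toLinearMap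

/-- The spherical harmonics of degree `ℓ`: restrictions to the sphere of the homogeneous harmonic
polynomials of degree `ℓ`. -/
def harmonicSpace (ℓ : ℕ) : Submodule ℂ (S2 → ℂ) where
  carrier := {f | ∃ p : MvPolynomial (Fin 3) ℂ,
    p.IsHomogeneous ℓ ∧ laplacian p = 0 ∧ f = restrictPoly p}
  add_mem' := by
    rintro _ _ ⟨p, hp, hp', rfl⟩ ⟨q, hq, hq', rfl⟩
    refine ⟨p + q, hp.add hq, by rw [map_add, hp', hq', add_zero], ?_⟩
    funext x
    simp [restrictPoly]
  zero_mem' := by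
    refine ⟨0, MvPolynomial.isHomogeneous_zero _ _ _, map_zero _, ?_⟩
    funext x
    simp [restrictPoly]
  smul_mem' := by
    rintro c _ ⟨p, hp, hp', rfl⟩
    refine ⟨c • p, (MvPolynomial.homogeneousSubmodule (Fin 3) ℂ ℓ).smul_mem c hp,
      by rw [map_smul, hp', smul_zero], ?_⟩
    funext x
    simp [restrictPoly]

/-- The orders `m = -ℓ, …, ℓ` belonging to the degree `ℓ`. -/
abbrev orders (ℓ : ℕ) : Finset ℤ := Finset.Icc (-(ℓ : ℤ)) (ℓ : ℤ)

/-- `Y ℓ m`, for `m = -ℓ, …, ℓ`, is for every degree `ℓ` an orthonormal basis of the space of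
spherical harmonics of degree `ℓ`, with respect to the inner product of the space of
square-integrable functions on the sphere. (Values of `Y ℓ m` at other `m` play no role.) -/
structure IsSphericalHarmonics (Y : ℕ → ℤ → S2 → ℂ) : Prop where
  orthonormal : ∀ ℓ : ℕ, ∀ m ∈ orders ℓ, ∀ m' ∈ orders ℓ,
    ∫ x, Y ℓ m x * conj (Y ℓ m' x) ∂surf = if m = m' then 1 else 0
  span_eq : ∀ ℓ : ℕ, Submodule.span ℂ (Y ℓ '' (orders ℓ : Set ℤ)) = harmonicSpace ℓ

variable {Ω : Type*} [MeasurableSpace Ω]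

/-- A real random field on the sphere, jointly measurable and square integrable on the product of
the probability space and the sphere. -/
structure IsRandomField (P : Measure Ω) (T : Ω → S2 → ℝ) : Prop where
  measurable : Measurable (fun p : Ω × S2 => T p.1 p.2)
  memLp : MemLp (fun p : Ω × S2 => T p.1 p.2) 2 (P.prod surf)

/-- Strong isotropy: all finite-dimensional distributions are invariant under rotations. -/
def StronglyIsotropic (P : Measure Ω) (T : Ω → S2 → ℝ) : Prop :=
  ∀ (k : ℕ) (x : Fin k → S2) (ρ : E3 ≃ₗᵢ[ℝ] E3), IsRotation ρ →
    IdentDistrib (fun ω (i : Fin k) => T ω (x i)) (fun ω (i : Fin k) => T ω (rotate ρ (x i))) P P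

/-- The Fourier coefficient of degree `ℓ` and order `m` of the realization `ω` of the field. -/
def coeff (Y : ℕ → ℤ → S2 → ℂ) (T : Ω → S2 → ℝ) (ℓ : ℕ) (m : ℤ) (ω : Ω) : ℂ :=
  ∫ x, (T ω x : ℂ) * conj (Y ℓ m x) ∂surf

/-- The Euclidean norm of the vector of all Fourier coefficients of degree `ℓ`. -/
def blockNorm (Y : ℕ → ℤ → S2 → ℂ) (T : Ω → S2 → ℝ) (ℓ : ℕ) (ω : Ω) : ℝ :=
  Real.sqrt (∑ m ∈ orders ℓ, ‖coeff Y T ℓ m ω‖ ^ 2)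

/-- The regularized coefficients, with regularization parameter `lam` and degree-scaling
sequence `β`. -/
def regCoeff (Y : ℕ → ℤ → S2 → ℂ) (β : ℕ → ℝ) (lam : ℝ) (T : Ω → S2 → ℝ)
    (ℓ : ℕ) (m : ℤ) (ω : Ω) : ℂ :=
  if lam * β ℓ < blockNorm Y T ℓ ω then
    ((1 - lam * β ℓ / blockNorm Y T ℓ ω : ℝ) : ℂ) * coeff Y T ℓ m ω
  else 0

/-- The sum over all degrees `ℓ < N` of the spherical harmonic expansion with the regularized
coefficients. -/
def regPartialSum (Y : ℕ → ℤ → S2 → ℂ) (β : ℕ → ℝ) (lam : ℝ) (T : Ω → S2 → ℝ)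
    (N : ℕ) (ω : Ω) (x : S2) : ℂ :=
  ∑ ℓ ∈ Finset.range N, ∑ m ∈ orders ℓ, regCoeff Y β lam T ℓ m ω * Y ℓ m x

/-- `Tr` is the regularized field of the observed field `To`: a random field which is the sum of
the spherical harmonic expansion with the regularized coefficients, both in the `L²` space of the
product of the probability space and the sphere, and at every single point `x` of the sphere in
the `L²` space of the probability space. (The first mode of convergence leaves the values of `Tr`
on a null set of points `x` undetermined, the second one fixes the random variable `Tr · x` almost
surely for every `x`.) -/
structure IsRegularizedField (P : Measure Ω) (Y : ℕ → ℤ → S2 → ℂ) (β : ℕ → ℝ) (lam : ℝ)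
    (To Tr : Ω → S2 → ℝ) : Prop where
  isRandomField : IsRandomField P Tr
  tendsto_prod : Tendsto (fun N : ℕ =>
    eLpNorm (fun p : Ω × S2 => (Tr p.1 p.2 : ℂ) - regPartialSum Y β lam To N p.1 p.2) 2
      (P.prod surf)) atTop (𝓝 0)
  tendsto_at : ∀ x : S2, Tendsto (fun N : ℕ =>
    eLpNorm (fun ω => (Tr ω x : ℂ) - regPartialSum Y β lam To N ω x) 2 P) atTop (𝓝 0)

end SphereField

end

/-!
Write `U_N(ω, x)` for the partial sum over the degrees below `N` of the regularized expansion.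
Three facts carry the proof.

*Regularization commutes with rotations.* Composition with a rotation maps the harmonic polynomials
of degree `ℓ` to themselves and preserves the surface measure, so it acts on the orthonormal basis
by a unitary matrix. Unitary changes of basis affect neither the projection to degree `ℓ` nor the
norm of the coefficient vector (`IsSphericalHarmonics.sum_coeff_eq`), hence
`U_N(T)(ρ x) = U_N(T ∘ ρ)(x)` (`regPartialSum_rotate`). The same argument with complex conjugation
in place of the rotation shows that `U_N` is real (`conj_regPartialSum`).

*Strong isotropy passes to Fourier coefficients.* Isotropy speaks of the values at finitely many
points, while the coefficients are integrals. For independent uniformly distributed points `ξ_k`,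
chosen independently of the field, the averages of `T(ξ_k) g(ξ_k)` converge to the integral of `T g`
by the strong law of large numbers, and for every choice of the points the joint law of these
averages is the same for `T` and for `T ∘ ρ`. So the coefficients of `T` and of `T ∘ ρ` have the
same joint law (`identDistrib_integral_mul`). With the first fact, the joint laws of the values of
`U_N` are invariant under rotations (`identDistrib_regPartialSum`), and so are those of the limit
(`IsRegularizedField.stronglyIsotropic`).

*The convergence is uniform in the point.* By the invariance just described, and since rotations act
transitively on the sphere, the mean square of `U_N(x) - U_M(x)` does not depend on `x`; it is
therefore its own average over the sphere, which by orthogonality is a piece of a series that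
converges by Bessel's inequality (`eLpNorm_regPartialSum_sub_le`). A fast subsequence of `U_N`
converges almost surely at each point, and its pointwise upper limit is a jointly measurable version
of the sum (`exists_limit_field`).

Orthogonality of different degrees comes from the Casimir operator of the rotation group, the sum of
the squares of the infinitesimal rotations: it is symmetric on the sphere and acts on the harmonic
polynomials of degree `ℓ` as `-ℓ (ℓ + 1)` (`integral_mul_conj_eq_zero`).
-/

noncomputable section

namespace SphereField

/-! ### Rotations of the sphere -/

instance : IsFiniteMeasure surf := by unfold surf; infer_instance

lemma continuous_rotate (ρ : E3 ≃ₗᵢ[ℝ] E3) : Continuous (rotate ρ) := by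
  unfold rotate
  fun_prop

lemma measurable_rotate (ρ : E3 ≃ₗᵢ[ℝ] E3) : Measurable (rotate ρ) :=
  (continuous_rotate ρ).measurable

open scoped Pointwise in
lemma measurePreserving_rotate (ρ : E3 ≃ₗᵢ[ℝ] E3) : MeasurePreserving (rotate ρ) surf surf := by
  refine ⟨measurable_rotate ρ, ?_⟩
  ext s hs
  have hs' := measurable_rotate ρ hs
  rw [Measure.map_apply (measurable_rotate ρ) hs, surf, Measure.toSphere_apply' _ hs',
    Measure.toSphere_apply' _ hs]
  congr 1
  -- The surface measure of `s` is three times the volume of the cone over `s`.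
  have h : Set.Ioo (0 : ℝ) 1 • ((↑) '' (rotate ρ ⁻¹' s) : Set E3)
      = ρ ⁻¹' (Set.Ioo (0 : ℝ) 1 • ((↑) '' s : Set E3)) := by
    ext y
    simp only [Set.mem_smul, Set.mem_image, Set.mem_preimage]
    constructor
    · rintro ⟨r, hr, _, ⟨x, hx, rfl⟩, rfl⟩
      exact ⟨r, hr, _, ⟨rotate ρ x, hx, rfl⟩, by simp [rotate]⟩
    · rintro ⟨r, hr, _, ⟨x, hx, rfl⟩, hy⟩
      refine ⟨r, hr, _, ⟨rotate ρ.symm x, ?_, rfl⟩, ?_⟩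
      · have : rotate ρ (rotate ρ.symm x) = x := by ext; simp [rotate]
        rwa [this]
      · apply ρ.injective
        simp [rotate, ← hy]
  rw [h]
  have := (ρ.measurePreserving).measure_preimage_equiv (f := ρ.toMeasurableEquiv)
    (Set.Ioo (0 : ℝ) 1 • ((↑) '' s : Set E3))
  exact this

/-- No condition on the determinant is needed: every linear isometry preserves the surface
measure. -/
lemma integral_comp_rotate (ρ : E3 ≃ₗᵢ[ℝ] E3) {F : Type*} [NormedAddCommGroup F] [NormedSpace ℝ F]
    (f : S2 → F) : ∫ x, f (rotate ρ x) ∂surf = ∫ x, f x ∂surf := by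
  have hemb : MeasurableEmbedding (rotate ρ) := by
    refine MeasurableEmbedding.of_measurable_inverse (g := rotate ρ.symm) (measurable_rotate ρ) ?_
      (measurable_rotate _) ?_
    · convert MeasurableSet.univ
      ext x
      simp only [Set.mem_range, Set.mem_univ, iff_true]
      exact ⟨rotate ρ.symm x, by ext; simp [rotate]⟩
    · intro x
      ext; simp [rotate]
  exact (measurePreserving_rotate ρ).integral_comp hemb f

lemma surf_ne_zero : surf ≠ 0 := by
  unfold surf
  exact Measure.toSphere_ne_zero _

lemma surf_univ_ne_zero : surf Set.univ ≠ 0 := by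
  simpa using surf_ne_zero

/-- The half-turn about the line spanned by a nonzero vector is a rotation. -/
lemma isRotation_reflection_span {u : E3} (hu : u ≠ 0) :
    IsRotation (ℝ ∙ u).reflection := by
  unfold IsRotation
  have h := (ℝ ∙ u).det_reflection
  have h2 : Module.finrank ℝ (ℝ ∙ u)ᗮ = 2 := by
    have : Fact (Module.finrank ℝ E3 = 2 + 1) := ⟨by simp⟩
    exact Submodule.finrank_orthogonal_span_singleton hu
  rw [h2] at h
  simpa using h

/-- A half-turn takes `x` to `y`: about `x + y` if `y ≠ -x`, and about a vector orthogonal to `x`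
otherwise. -/
lemma exists_isRotation_rotate_eq (x y : S2) :
    ∃ ρ : E3 ≃ₗᵢ[ℝ] E3, IsRotation ρ ∧ rotate ρ x = y := by
  have hx : ‖(x : E3)‖ = 1 := by simp
  have hy : ‖(y : E3)‖ = 1 := by simp
  by_cases h : (x : E3) + y = 0
  · have h2 : Module.finrank ℝ (ℝ ∙ (x : E3))ᗮ = 2 := by
      have : Fact (Module.finrank ℝ E3 = 2 + 1) := ⟨by simp⟩
      exact Submodule.finrank_orthogonal_span_singleton (by rw [← norm_ne_zero_iff, hx]; simp)
    have : Nontrivial (ℝ ∙ (x : E3))ᗮ := Module.nontrivial_of_finrank_pos (R := ℝ) (by omega)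
    obtain ⟨⟨u, hu⟩, hu0⟩ := exists_ne (0 : (ℝ ∙ (x : E3))ᗮ)
    have hu0' : u ≠ 0 := fun h => hu0 (by simpa using h)
    refine ⟨_, isRotation_reflection_span hu0', ?_⟩
    ext1
    have hx' : (x : E3) ∈ (ℝ ∙ u)ᗮ := by
      rw [Submodule.mem_orthogonal_singleton_iff_inner_right] at hu ⊢
      rwa [real_inner_comm]
    simp only [rotate]
    rw [Submodule.reflection_mem_subspace_orthogonalComplement_eq_neg hx']
    exact neg_eq_of_add_eq_zero_right h
  · refine ⟨_, isRotation_reflection_span h, ?_⟩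
    ext1
    have h1 := Submodule.reflection_mem_subspace_eq_self
      (Submodule.mem_span_singleton_self (R := ℝ) ((x : E3) + y))
    have h2 : (x : E3) - y ∈ (ℝ ∙ ((x : E3) + y))ᗮ := by
      rw [Submodule.mem_orthogonal_singleton_iff_inner_right]
      rw [real_inner_add_sub_eq_zero_iff, hx, hy]
    have h2 := Submodule.reflection_mem_subspace_orthogonalComplement_eq_neg h2
    rw [map_add] at h1
    rw [map_sub] at h2
    simp only [rotate]
    have h3 : (2 : ℝ) • (ℝ ∙ ((x : E3) + y)).reflection x = (2 : ℝ) • (y : E3) := by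
      calc (2 : ℝ) • (ℝ ∙ ((x : E3) + y)).reflection x
          = ((ℝ ∙ ((x : E3) + y)).reflection x + (ℝ ∙ ((x : E3) + y)).reflection y)
            + ((ℝ ∙ ((x : E3) + y)).reflection x - (ℝ ∙ ((x : E3) + y)).reflection y) := by module
        _ = (2 : ℝ) • (y : E3) := by rw [h1, h2]; module
    exact smul_right_injective _ (two_ne_zero (α := ℝ)) h3

/-- The map rotating the plane of the coordinates `i ≠ j` by the angle `t`, and fixing the third
coordinate. -/
def planeRot (i j : Fin 3) (t : ℝ) (x : E3) : E3 :=
  WithLp.toLp 2 fun k =>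
    if k = i then Real.cos t * x i - Real.sin t * x j
    else if k = j then Real.sin t * x i + Real.cos t * x j
    else x k

/-- The map `planeRot i j t` as a linear isometry. -/
def planeRotation {i j : Fin 3} (hij : i ≠ j) (t : ℝ) : E3 ≃ₗᵢ[ℝ] E3 :=
  LinearIsometryEquiv.mk
    { toFun := planeRot i j t
      invFun := planeRot i j (-t)
      map_add' := fun x y => by
        ext k
        simp only [planeRot, PiLp.add_apply]
        split_ifs <;> ring
      map_smul' := fun c x => by
        ext k
        simp only [planeRot, PiLp.smul_apply, smul_eq_mul, RingHom.id_apply]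
        split_ifs <;> ring
      left_inv := fun x => by
        ext k
        have h := Real.sin_sq_add_cos_sq t
        simp only [planeRot, Real.cos_neg, Real.sin_neg, if_true, if_neg hij.symm]
        split_ifs with h1 h2
        · subst h1; linear_combination x k * h
        · subst h2; linear_combination x k * h
        · rfl
      right_inv := fun x => by
        ext k
        have h := Real.sin_sq_add_cos_sq t
        simp only [planeRot, Real.cos_neg, Real.sin_neg, if_true, if_neg hij.symm]
        split_ifs with h1 h2
        · subst h1; linear_combination x k * h
        · subst h2; linear_combination x k * h
        · rfl }
    (fun x => by
      have h := Real.sin_sq_add_cos_sq t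
      have key : ∑ k, (planeRot i j t x k) ^ 2 = ∑ k, x k ^ 2 := by
        simp only [planeRot]
        fin_cases i <;> fin_cases j <;> first | exact absurd rfl hij | skip
        all_goals simp [Fin.sum_univ_three]
        · linear_combination (x 0 ^ 2 + x 1 ^ 2) * h
        · linear_combination (x 0 ^ 2 + x 2 ^ 2) * h
        · linear_combination (x 0 ^ 2 + x 1 ^ 2) * h
        · linear_combination (x 1 ^ 2 + x 2 ^ 2) * h
        · linear_combination (x 0 ^ 2 + x 2 ^ 2) * h
        · linear_combination (x 1 ^ 2 + x 2 ^ 2) * h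
      simp only [EuclideanSpace.norm_eq, Real.norm_eq_abs, sq_abs]
      exact congrArg Real.sqrt key)

lemma planeRotation_apply {i j : Fin 3} (hij : i ≠ j) (t : ℝ) (x : E3) :
    planeRotation hij t x = planeRot i j t x := rfl

/-! ### Spherical harmonics of different degrees are orthogonal -/

lemma continuous_restrictPoly (p : MvPolynomial (Fin 3) ℂ) : Continuous (restrictPoly p) := by
  unfold restrictPoly
  refine (MvPolynomial.continuous_eval p).comp ?_
  fun_prop

lemma integrable_of_continuous {f : S2 → ℂ} (hf : Continuous f) : Integrable f surf := by
  obtain ⟨C, hC⟩ := IsCompact.exists_bound_of_continuousOn isCompact_univ hf.continuousOn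
  exact Integrable.of_bound hf.aestronglyMeasurable C (ae_of_all _ fun x => hC x trivial)

lemma continuous_of_mem_harmonicSpace {ℓ : ℕ} {f : S2 → ℂ} (hf : f ∈ harmonicSpace ℓ) :
    Continuous f := by
  obtain ⟨p, -, -, rfl⟩ := hf
  exact continuous_restrictPoly p

lemma laplacian_apply (p : MvPolynomial (Fin 3) ℂ) :
    laplacian p = ∑ i, MvPolynomial.pderiv i (MvPolynomial.pderiv i p) := by
  simp [laplacian, LinearMap.sum_apply]

/-- Complex conjugation of the coefficients. -/
def conjPoly : MvPolynomial (Fin 3) ℂ →+* MvPolynomial (Fin 3) ℂ :=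
  MvPolynomial.map (starRingEnd ℂ)

lemma restrictPoly_conjPoly (p : MvPolynomial (Fin 3) ℂ) (x : S2) :
    restrictPoly (conjPoly p) x = conj (restrictPoly p x) := by
  unfold restrictPoly conjPoly
  rw [MvPolynomial.eval_map, ← MvPolynomial.eval₂_id, MvPolynomial.hom_eval₂]
  simp only [RingHom.comp_id]
  congr 1
  ext i
  simp

lemma laplacian_conjPoly {p : MvPolynomial (Fin 3) ℂ} (hp : laplacian p = 0) :
    laplacian (conjPoly p) = 0 := by
  rw [laplacian_apply] at hp ⊢
  simp only [conjPoly, MvPolynomial.pderiv_map, ← map_sum, hp, map_zero]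

lemma conj_mem_harmonicSpace {ℓ : ℕ} {f : S2 → ℂ} (hf : f ∈ harmonicSpace ℓ) :
    (fun x => conj (f x)) ∈ harmonicSpace ℓ := by
  obtain ⟨p, hp, hp', rfl⟩ := hf
  exact ⟨conjPoly p, hp.map _, laplacian_conjPoly hp', by ext x; rw [restrictPoly_conjPoly]⟩

/-- The entry in row `j` and column `i` of the matrix of a linear isometry. -/
def entry (ρ : E3 ≃ₗᵢ[ℝ] E3) (j i : Fin 3) : ℝ := ρ (EuclideanSpace.single i 1) j

lemma apply_eq_sum_entry (ρ : E3 ≃ₗᵢ[ℝ] E3) (x : E3) (j : Fin 3) :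
    ρ x j = ∑ i, entry ρ j i * x i := by
  have h : x = ∑ i, x i • EuclideanSpace.single i (1 : ℝ) := by
    ext k
    simp [Finset.sum_apply, Pi.single_apply]
  conv_lhs => rw [h]
  simp only [map_sum, map_smul, entry, WithLp.ofLp_sum, Finset.sum_apply, PiLp.smul_apply,
    smul_eq_mul]
  exact Finset.sum_congr rfl fun i _ => mul_comm _ _

/-- The rows of the matrix of a linear isometry are orthonormal. -/
lemma sum_entry_mul_entry (ρ : E3 ≃ₗᵢ[ℝ] E3) (j k : Fin 3) :
    ∑ i, entry ρ j i * entry ρ k i = if j = k then 1 else 0 := by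
  -- The rows of the matrix of `ρ` are the columns of the matrix of its inverse.
  have h : ∀ j i, entry ρ j i = ρ.symm (EuclideanSpace.single j 1) i := by
    intro j i
    have := ρ.inner_map_map (EuclideanSpace.single i (1 : ℝ))
      (ρ.symm (EuclideanSpace.single j (1 : ℝ)))
    rw [ρ.apply_symm_apply] at this
    simpa [entry, EuclideanSpace.inner_single_left, EuclideanSpace.inner_single_right] using this
  have := ρ.symm.inner_map_map (EuclideanSpace.single j (1 : ℝ)) (EuclideanSpace.single k (1 : ℝ))
  simp only [PiLp.inner_apply (𝕜 := ℝ), ← h] at this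
  simp [Fin.sum_univ_three, PiLp.single_apply] at this ⊢
  fin_cases j <;> fin_cases k <;> simp at this ⊢ <;> linear_combination this

/-- The linear change of variables `p ↦ p ∘ ρ`. -/
def substPoly (ρ : E3 ≃ₗᵢ[ℝ] E3) : MvPolynomial (Fin 3) ℂ →ₐ[ℂ] MvPolynomial (Fin 3) ℂ :=
  MvPolynomial.aeval fun j => ∑ i, MvPolynomial.C (entry ρ j i : ℂ) * MvPolynomial.X i

lemma restrictPoly_substPoly (ρ : E3 ≃ₗᵢ[ℝ] E3) (p : MvPolynomial (Fin 3) ℂ) (x : S2) :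
    restrictPoly (substPoly ρ p) x = restrictPoly p (rotate ρ x) := by
  unfold restrictPoly substPoly
  induction p using MvPolynomial.induction_on with
  | C a => simp
  | add p q hp hq => simp only [map_add, hp, hq]
  | mul_X p j hp =>
    simp only [map_mul, hp, MvPolynomial.aeval_X, MvPolynomial.eval_X, rotate,
      apply_eq_sum_entry ρ]
    simp

/-- The chain rule for a linear change of variables. -/
lemma pderiv_substPoly (ρ : E3 ≃ₗᵢ[ℝ] E3) (p : MvPolynomial (Fin 3) ℂ) (i : Fin 3) :
    MvPolynomial.pderiv i (substPoly ρ p)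
      = ∑ j, MvPolynomial.C (entry ρ j i : ℂ) * substPoly ρ (MvPolynomial.pderiv j p) := by
  unfold substPoly
  induction p using MvPolynomial.induction_on with
  | C a => simp
  | add p q hp hq => simp only [map_add, hp, hq, mul_add, Finset.sum_add_distrib]
  | mul_X p k hp =>
    simp only [map_mul, MvPolynomial.pderiv_mul, hp, MvPolynomial.aeval_X, map_add, mul_add,
      Finset.sum_add_distrib, Finset.sum_mul, map_sum,
      MvPolynomial.pderiv_C, MvPolynomial.pderiv_X]
    congr 1
    · exact Finset.sum_congr rfl fun j _ => by ring
    · simp [Pi.single_apply, apply_ite, Finset.sum_ite_eq, mul_comm]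

lemma laplacian_substPoly (ρ : E3 ≃ₗᵢ[ℝ] E3) (p : MvPolynomial (Fin 3) ℂ) :
    laplacian (substPoly ρ p) = substPoly ρ (laplacian p) := by
  simp only [laplacian_apply, pderiv_substPoly, map_sum, MvPolynomial.pderiv_C_mul, Finset.mul_sum]
  rw [Finset.sum_comm]
  refine Finset.sum_congr rfl fun j _ => ?_
  rw [Finset.sum_comm]
  have h : ∀ k, ∑ i, (MvPolynomial.C (entry ρ j i : ℂ) * (MvPolynomial.C (entry ρ k i : ℂ)
      * substPoly ρ (MvPolynomial.pderiv k (MvPolynomial.pderiv j p))) : MvPolynomial (Fin 3) ℂ)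
      = if j = k then substPoly ρ (MvPolynomial.pderiv k (MvPolynomial.pderiv j p)) else 0 := by
    intro k
    have := congrArg (fun r : ℝ => (MvPolynomial.C (r : ℂ) : MvPolynomial (Fin 3) ℂ))
      (sum_entry_mul_entry ρ j k)
    simp only [Complex.ofReal_sum, Complex.ofReal_mul, map_sum, map_mul] at this
    simp only [← mul_assoc, ← Finset.sum_mul, this]
    split_ifs <;> simp
  rw [Finset.sum_congr rfl fun k _ => h k]
  simp

lemma comp_rotate_mem_harmonicSpace (ρ : E3 ≃ₗᵢ[ℝ] E3) {ℓ : ℕ} {f : S2 → ℂ}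
    (hf : f ∈ harmonicSpace ℓ) : (fun x => f (rotate ρ x)) ∈ harmonicSpace ℓ := by
  obtain ⟨p, hp, hp', rfl⟩ := hf
  refine ⟨substPoly ρ p, ?_, by rw [laplacian_substPoly, hp', map_zero], ?_⟩
  · have := hp.aeval (fun j => ∑ i, MvPolynomial.C (entry ρ j i : ℂ) * MvPolynomial.X i) (n := 1)
      (fun j => MvPolynomial.IsHomogeneous.sum _ _ _ fun i _ =>
        (MvPolynomial.isHomogeneous_C_mul_X _ _))
    simpa [substPoly] using this
  · ext x
    rw [restrictPoly_substPoly]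

/-- The infinitesimal rotation `x_i ∂_j - x_j ∂_i`. -/
def infRot (i j : Fin 3) : Derivation ℂ (MvPolynomial (Fin 3) ℂ) (MvPolynomial (Fin 3) ℂ) :=
  (MvPolynomial.X i : MvPolynomial (Fin 3) ℂ) • MvPolynomial.pderiv j
    - (MvPolynomial.X j : MvPolynomial (Fin 3) ℂ) • MvPolynomial.pderiv i

lemma infRot_apply (i j : Fin 3) (p : MvPolynomial (Fin 3) ℂ) :
    infRot i j p = MvPolynomial.X i * MvPolynomial.pderiv j p
      - MvPolynomial.X j * MvPolynomial.pderiv i p := by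
  simp [infRot]

/-- A curve that follows a derivation on the coordinates follows it on all polynomials. -/
lemma hasDerivAt_eval {D : Derivation ℂ (MvPolynomial (Fin 3) ℂ) (MvPolynomial (Fin 3) ℂ)}
    {c : ℝ → Fin 3 → ℂ} {t : ℝ}
    (hc : ∀ k, HasDerivAt (fun s => c s k) (MvPolynomial.eval (c t) (D (MvPolynomial.X k))) t)
    (p : MvPolynomial (Fin 3) ℂ) :
    HasDerivAt (fun s => MvPolynomial.eval (c s) p) (MvPolynomial.eval (c t) (D p)) t := by
  induction p using MvPolynomial.induction_on with
  | C a =>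
    have : D (MvPolynomial.C a) = 0 := D.map_algebraMap a
    simpa [this] using hasDerivAt_const t a
  | add p q hp hq => simp only [map_add]; exact hp.fun_add hq
  | mul_X p k hp =>
    simp only [map_mul, MvPolynomial.eval_X, Derivation.leibniz, smul_eq_mul, map_add]
    exact (hp.fun_mul (hc k)).congr_deriv (by ring)

lemma hasDerivAt_restrictPoly_planeRotation {i j : Fin 3} (hij : i ≠ j)
    (p : MvPolynomial (Fin 3) ℂ) (x : S2) (t : ℝ) :
    HasDerivAt (fun s => restrictPoly p (rotate (planeRotation hij s) x))
      (restrictPoly (infRot i j p) (rotate (planeRotation hij t) x)) t := by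
  unfold restrictPoly
  refine hasDerivAt_eval (fun k => ?_) p
  have hcos := Real.hasDerivAt_cos t
  have hsin := Real.hasDerivAt_sin t
  simp only [rotate, planeRotation_apply, planeRot, infRot_apply, MvPolynomial.pderiv_X,
    map_sub, map_mul, MvPolynomial.eval_X]
  by_cases hki : k = i
  · subst hki
    simp only [if_true, if_neg hij.symm, Pi.single_eq_same, Pi.single_eq_of_ne hij, map_one,
      map_zero]
    refine ((hcos.mul_const ((x : E3) k)).fun_sub
      (hsin.mul_const ((x : E3) j))).ofReal_comp.congr_deriv ?_
    push_cast
    ring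
  · by_cases hkj : k = j
    · subst hkj
      simp only [if_true, if_neg hij.symm, Pi.single_eq_same, Pi.single_eq_of_ne hij.symm, map_one,
        map_zero]
      refine ((hsin.mul_const ((x : E3) i)).fun_add
        (hcos.mul_const ((x : E3) k))).ofReal_comp.congr_deriv ?_
      push_cast
      ring
    · simp only [if_neg hki, if_neg hkj, Pi.single_eq_of_ne hki, Pi.single_eq_of_ne hkj, map_zero]
      simpa using hasDerivAt_const t _

/-- The integral over the sphere of an infinitesimal rotation of a polynomial vanishes, since the
integral of a rotated polynomial does not depend on the angle. -/
lemma integral_infRot {i j : Fin 3} (hij : i ≠ j) (p : MvPolynomial (Fin 3) ℂ) :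
    ∫ x, restrictPoly (infRot i j p) x ∂surf = 0 := by
  obtain ⟨C, hC⟩ := IsCompact.exists_bound_of_continuousOn isCompact_univ
    (continuous_restrictPoly (infRot i j p)).continuousOn
  have hcont : ∀ q t, Continuous fun x => restrictPoly q (rotate (planeRotation hij t) x) :=
    fun q t => (continuous_restrictPoly q).comp (continuous_rotate _)
  have h := (hasDerivAt_integral_of_dominated_loc_of_deriv_le (μ := surf) (x₀ := (0 : ℝ))
    (s := Set.univ) (F := fun t x => restrictPoly p (rotate (planeRotation hij t) x))
    (F' := fun t x => restrictPoly (infRot i j p) (rotate (planeRotation hij t) x))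
    (bound := fun _ => C) univ_mem
    (Eventually.of_forall fun t => (hcont p t).aestronglyMeasurable)
    (integrable_of_continuous (hcont p 0)) (hcont _ 0).aestronglyMeasurable
    (ae_of_all _ fun x t _ => hC _ trivial) (integrable_const C)
    (ae_of_all _ fun x t _ => hasDerivAt_restrictPoly_planeRotation hij p x t)).2
  simp only [integral_comp_rotate] at h
  exact h.unique (hasDerivAt_const 0 _)

lemma restrictPoly_mul (p q : MvPolynomial (Fin 3) ℂ) (x : S2) :
    restrictPoly (p * q) x = restrictPoly p x * restrictPoly q x := by
  simp [restrictPoly]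

/-- Infinitesimal rotations are antisymmetric on the sphere. -/
lemma integral_infRot_mul {i j : Fin 3} (hij : i ≠ j) (p q : MvPolynomial (Fin 3) ℂ) :
    ∫ x, restrictPoly (infRot i j p * q) x ∂surf
      = - ∫ x, restrictPoly (p * infRot i j q) x ∂surf := by
  have h := integral_infRot hij (p * q)
  have h' : ∀ x, restrictPoly (infRot i j (p * q)) x
      = restrictPoly (infRot i j p * q) x + restrictPoly (p * infRot i j q) x := by
    intro x
    simp only [Derivation.leibniz, smul_eq_mul, restrictPoly, map_add, map_mul]
    ring
  simp only [h'] at h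
  rw [integral_add (integrable_of_continuous (continuous_restrictPoly _))
    (integrable_of_continuous (continuous_restrictPoly _))] at h
  exact eq_neg_of_add_eq_zero_left h

/-- The Casimir operator of the rotation group: the sum of the squares of the infinitesimal
rotations in the coordinate planes. -/
def casimir (p : MvPolynomial (Fin 3) ℂ) : MvPolynomial (Fin 3) ℂ :=
  infRot 0 1 (infRot 0 1 p) + infRot 0 2 (infRot 0 2 p) + infRot 1 2 (infRot 1 2 p)

lemma integral_casimir_mul (p q : MvPolynomial (Fin 3) ℂ) :
    ∫ x, restrictPoly (casimir p * q) x ∂surf = ∫ x, restrictPoly (p * casimir q) x ∂surf := by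
  have hint : ∀ r, Integrable (restrictPoly r) surf :=
    fun r => integrable_of_continuous (continuous_restrictPoly r)
  have hsplit : ∀ a b c : MvPolynomial (Fin 3) ℂ, ∫ x, restrictPoly (a + b + c) x ∂surf
      = ∫ x, restrictPoly a x ∂surf + ∫ x, restrictPoly b x ∂surf
        + ∫ x, restrictPoly c x ∂surf := by
    intro a b c
    have h1 := integral_add (hint a) (hint b)
    have h2 := integral_add ((hint a).add (hint b)) (hint c)
    simp only [Pi.add_apply] at h2
    rw [← h1, ← h2]
    simp [restrictPoly]
  simp only [casimir, add_mul, mul_add, hsplit]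
  rw [integral_infRot_mul (by decide), integral_infRot_mul (by decide),
    integral_infRot_mul (by decide), integral_infRot_mul (by decide),
    integral_infRot_mul (by decide), integral_infRot_mul (by decide)]
  simp

lemma pderiv_comm (i j : Fin 3) (p : MvPolynomial (Fin 3) ℂ) :
    MvPolynomial.pderiv i (MvPolynomial.pderiv j p)
      = MvPolynomial.pderiv j (MvPolynomial.pderiv i p) := by
  induction p using MvPolynomial.induction_on with
  | C a => simp
  | add p q hp hq => simp [hp, hq]
  | mul_X p k hp =>
    simp only [MvPolynomial.pderiv_mul, map_add, hp, MvPolynomial.pderiv_X, Pi.single_apply]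
    split_ifs <;> (simp; try ring)

/-- On homogeneous harmonic polynomials of degree `ℓ` the Casimir operator is multiplication by
`-ℓ (ℓ + 1)`: it equals `|x|² Δ - E² - E`, where `E` is the Euler operator. -/
lemma casimir_eq {ℓ : ℕ} {p : MvPolynomial (Fin 3) ℂ} (hp : p.IsHomogeneous ℓ)
    (hp' : laplacian p = 0) : casimir p = MvPolynomial.C (-((ℓ : ℂ) * (ℓ + 1))) * p := by
  have hE := hp.sum_X_mul_pderiv
  rw [laplacian_apply, Fin.sum_univ_three] at hp'
  rw [Fin.sum_univ_three, nsmul_eq_mul] at hE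
  -- The partial derivatives of Euler's identity express `E² p` through second derivatives.
  have hE0 := congrArg (MvPolynomial.pderiv 0) hE
  have hE1 := congrArg (MvPolynomial.pderiv 1) hE
  have hE2 := congrArg (MvPolynomial.pderiv 2) hE
  have h10 := pderiv_comm 1 0 p
  have h20 := pderiv_comm 2 0 p
  have h21 := pderiv_comm 2 1 p
  simp only [casimir, infRot_apply]
  simp only [map_sub, map_add, MvPolynomial.pderiv_mul, MvPolynomial.pderiv_X,
    h10, h20, h21] at hE0 hE1 hE2 ⊢
  simp at hE0 hE1 hE2 ⊢
  linear_combination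
    ((MvPolynomial.X 0) ^ 2 + (MvPolynomial.X 1) ^ 2 + (MvPolynomial.X 2) ^ 2) * hp'
    - MvPolynomial.X 0 * hE0 - MvPolynomial.X 1 * hE1 - MvPolynomial.X 2 * hE2
    - ((ℓ : MvPolynomial (Fin 3) ℂ) + 1) * hE

/-- Spherical harmonics of different degrees are orthogonal: the Casimir operator is symmetric and
has different eigenvalues on them. -/
lemma integral_mul_conj_eq_zero {ℓ ℓ' : ℕ} (h : ℓ ≠ ℓ') {f g : S2 → ℂ}
    (hf : f ∈ harmonicSpace ℓ) (hg : g ∈ harmonicSpace ℓ') :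
    ∫ x, f x * conj (g x) ∂surf = 0 := by
  obtain ⟨p, hp, hp', rfl⟩ := hf
  obtain ⟨q, hq, hq', hgq⟩ := conj_mem_harmonicSpace hg
  have hgq' : ∀ x, conj (g x) = restrictPoly q x := fun x => congrFun hgq x
  simp only [hgq', ← restrictPoly_mul]
  have key := integral_casimir_mul p q
  rw [casimir_eq hp hp', casimir_eq hq hq', mul_left_comm p, mul_assoc] at key
  have hC : ∀ (c : ℂ) r, ∫ x, restrictPoly (MvPolynomial.C c * r) x ∂surf
      = c * ∫ x, restrictPoly r x ∂surf := by
    intro c r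
    rw [← integral_const_mul]
    simp [restrictPoly]
  rw [hC, hC, ← sub_eq_zero, ← sub_mul] at key
  refine (mul_eq_zero.mp key).resolve_left ?_
  have h1 : ((ℓ * (ℓ + 1) : ℕ) : ℂ) ≠ ((ℓ' * (ℓ' + 1) : ℕ) : ℂ) := by
    rw [Ne, Nat.cast_inj]
    intro h2
    rcases lt_or_gt_of_ne h with h3 | h3 <;> nlinarith
  push_cast at h1
  intro h2
  apply h1
  linear_combination -h2

/-! ### Change of basis and the action of isometries on the expansion -/

section

lemma integrable_mul_of_continuous {f g : S2 → ℂ} (hf : Integrable f surf) (hg : Continuous g) :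
    Integrable (fun x => f x * g x) surf := by
  obtain ⟨C, hC⟩ := IsCompact.exists_bound_of_continuousOn isCompact_univ hg.continuousOn
  exact hf.mul_bdd (c := C) hg.aestronglyMeasurable (ae_of_all _ fun x => hC x trivial)

lemma IsSphericalHarmonics.mem_harmonicSpace {Y : ℕ → ℤ → S2 → ℂ} (hY : IsSphericalHarmonics Y)
    {ℓ : ℕ} {m : ℤ} (hm : m ∈ orders ℓ) : Y ℓ m ∈ harmonicSpace ℓ := by
  rw [← hY.span_eq]
  exact Submodule.subset_span ⟨m, hm, rfl⟩

lemma IsSphericalHarmonics.continuous {Y : ℕ → ℤ → S2 → ℂ} (hY : IsSphericalHarmonics Y)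
    {ℓ : ℕ} {m : ℤ} (hm : m ∈ orders ℓ) : Continuous (Y ℓ m) :=
  continuous_of_mem_harmonicSpace (hY.mem_harmonicSpace hm)

lemma IsSphericalHarmonics.integral_mul_conj {Y : ℕ → ℤ → S2 → ℂ} (hY : IsSphericalHarmonics Y)
    {ℓ ℓ' : ℕ} {m m' : ℤ} (hm : m ∈ orders ℓ) (hm' : m' ∈ orders ℓ') :
    ∫ x, Y ℓ m x * conj (Y ℓ' m' x) ∂surf = if ℓ = ℓ' ∧ m = m' then 1 else 0 := by
  by_cases h : ℓ = ℓ'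
  · subst h
    simp [hY.orthonormal ℓ m hm m' hm']
  · rw [integral_mul_conj_eq_zero h (hY.mem_harmonicSpace hm) (hY.mem_harmonicSpace hm')]
    simp [h]

open Matrix in
/-- Two orthonormal bases of the spherical harmonics of degree `ℓ` are related by a unitary
matrix. -/
lemma IsSphericalHarmonics.exists_unitary {Y : ℕ → ℤ → S2 → ℂ} (hY : IsSphericalHarmonics Y)
    {ℓ : ℕ} {Z : ℤ → S2 → ℂ} (hZ : ∀ m ∈ orders ℓ, Z m ∈ harmonicSpace ℓ)
    (hZo : ∀ m ∈ orders ℓ, ∀ m' ∈ orders ℓ,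
      ∫ x, Z m x * conj (Z m' x) ∂surf = if m = m' then 1 else 0) :
    ∃ C : Matrix (orders ℓ) (orders ℓ) ℂ, 
      (∀ (m : orders ℓ) (x : S2), Z m x = ∑ m', C m m' * Y ℓ m' x) ∧
      Cᴴ * C = 1 := by
  have h : ∀ m : orders ℓ, ∃ c : orders ℓ → ℂ, ∑ m', c m' • Y ℓ m' = Z m := by
    intro m
    rw [← Submodule.mem_span_range_iff_exists_fun]
    have := hZ m m.2
    rw [← hY.span_eq, Set.image_eq_range] at this
    exact this
  choose c hc using h
  obtain ⟨C, hC⟩ : ∃ C : Matrix (orders ℓ) (orders ℓ) ℂ, ∀ m, ∑ m', C m m' • Y ℓ m' = Z m :=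
    ⟨Matrix.of c, hc⟩
  have hC' : ∀ (m : orders ℓ) (x : S2), Z m x = ∑ m', C m m' * Y ℓ m' x := by
    intro m x
    rw [← hC m]
    simp [Finset.sum_apply]
  refine ⟨C, hC', ?_⟩
  -- Orthonormality of `Z` gives `C * Cᴴ = 1`, which suffices as `C` is square.
  rw [mul_eq_one_comm]
  ext m n
  have h1 := hZo m m.2 n n.2
  have hint : ∀ k k' : orders ℓ, Integrable (fun x => (C m k * conj (C n k'))
      * (Y ℓ k x * conj (Y ℓ k' x))) surf := fun k k' =>
    (integrable_of_continuous ((hY.continuous k.2).mul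
      (Complex.continuous_conj.comp (hY.continuous k'.2)))).const_mul _
  have h2 : ∀ x, Z m x * conj (Z n x) = ∑ k, ∑ k', (C m k * conj (C n k'))
      * (Y ℓ k x * conj (Y ℓ k' x)) := by
    intro x
    rw [hC', hC', map_sum, Finset.sum_mul_sum]
    refine Finset.sum_congr rfl fun k _ => Finset.sum_congr rfl fun k' _ => ?_
    rw [map_mul]
    ring
  simp only [h2] at h1
  rw [integral_finsetSum _ fun k _ => integrable_finsetSum _ fun k' _ => hint k k'] at h1
  simp only [integral_finsetSum _ fun k' _ => hint _ k', integral_const_mul] at h1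
  simp only [fun k k' : orders ℓ => hY.orthonormal ℓ k k.2 k' k'.2] at h1
  simp only [Matrix.mul_apply, Matrix.conjTranspose_apply, Matrix.one_apply]
  simp only [← Subtype.ext_iff, mul_ite, mul_one, mul_zero, Finset.sum_ite_eq, Finset.mem_univ,
    if_true] at h1
  exact h1

open Matrix in
/-- A unitary matrix preserves the bilinear pairing of `u` and `v` if its conjugate acts on `u` and
it acts on `v` itself. -/
lemma sum_unitary_mul {ι : Type*} [Fintype ι] [DecidableEq ι] {C : Matrix ι ι ℂ}
    (hC : Cᴴ * C = 1) (u v : ι → ℂ) :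
    ∑ m, (∑ n, conj (C m n) * u n) * (∑ n, C m n * v n) = ∑ n, u n * v n := by
  have h : ∀ n n', ∑ m, conj (C m n) * C m n' = if n = n' then 1 else 0 := by
    intro n n'
    have := congrFun (congrFun hC n) n'
    simpa [Matrix.mul_apply, Matrix.conjTranspose_apply, Matrix.one_apply] using this
  calc ∑ m, (∑ n, conj (C m n) * u n) * (∑ n, C m n * v n)
      = ∑ m, ∑ n, ∑ n', (conj (C m n) * C m n') * (u n * v n') := by
        refine Finset.sum_congr rfl fun m _ => ?_
        rw [Finset.sum_mul_sum]
        exact Finset.sum_congr rfl fun n _ => Finset.sum_congr rfl fun n' _ => by ring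
    _ = ∑ n, ∑ n', (∑ m, conj (C m n) * C m n') * (u n * v n') := by
        rw [Finset.sum_comm]
        refine Finset.sum_congr rfl fun n _ => ?_
        rw [Finset.sum_comm]
        exact Finset.sum_congr rfl fun n' _ => by rw [Finset.sum_mul]
    _ = ∑ n, u n * v n := by simp [h]

/-- The projection to the spherical harmonics of degree `ℓ`, and the norm of the coefficient vector,
do not depend on the choice of the orthonormal basis. -/
lemma IsSphericalHarmonics.sum_coeff_eq {Y : ℕ → ℤ → S2 → ℂ} (hY : IsSphericalHarmonics Y)
    {ℓ : ℕ} {Z : ℤ → S2 → ℂ} (hZ : ∀ m ∈ orders ℓ, Z m ∈ harmonicSpace ℓ)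
    (hZo : ∀ m ∈ orders ℓ, ∀ m' ∈ orders ℓ,
      ∫ x, Z m x * conj (Z m' x) ∂surf = if m = m' then 1 else 0)
    {f : S2 → ℂ} (hf : Integrable f surf) :
    (∀ x, ∑ m ∈ orders ℓ, (∫ y, f y * conj (Z m y) ∂surf) * Z m x
      = ∑ m ∈ orders ℓ, (∫ y, f y * conj (Y ℓ m y) ∂surf) * Y ℓ m x) ∧
    ∑ m ∈ orders ℓ, ‖∫ y, f y * conj (Z m y) ∂surf‖ ^ 2
      = ∑ m ∈ orders ℓ, ‖∫ y, f y * conj (Y ℓ m y) ∂surf‖ ^ 2 := by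
  obtain ⟨C, hC, hCu⟩ := hY.exists_unitary hZ hZo
  have hb : ∀ m : orders ℓ, ∫ y, f y * conj (Z m y) ∂surf
      = ∑ n, conj (C m n) * ∫ y, f y * conj (Y ℓ n y) ∂surf := by
    intro m
    simp only [← integral_const_mul]
    have hint : ∀ n : orders ℓ,
        Integrable (fun y => conj (C m n) * (f y * conj (Y ℓ n y))) surf := fun n =>
      (integrable_mul_of_continuous hf
        (Complex.continuous_conj.comp (hY.continuous n.2))).const_mul _
    rw [← integral_finsetSum _ fun n _ => hint n]
    refine integral_congr_ae (ae_of_all _ fun y => ?_)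
    simp only [hC, map_sum, map_mul, Finset.mul_sum]
    exact Finset.sum_congr rfl fun n _ => by ring
  constructor
  · intro x
    rw [← Finset.sum_coe_sort, ← Finset.sum_coe_sort (orders ℓ)]
    simp only [hb]
    simp only [hC]
    exact sum_unitary_mul hCu _ _
  · rw [← Finset.sum_coe_sort, ← Finset.sum_coe_sort (orders ℓ)]
    apply Complex.ofReal_injective
    push_cast
    simp only [← Complex.mul_conj']
    simp only [hb, map_sum, map_mul, Complex.conj_conj]
    exact sum_unitary_mul hCu _ _

/-- The soft-thresholding factor with threshold `t` of a vector of norm `A`. For `t ≥ 0` the quotient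
is only used with `A > 0`. -/
def shrink (t A : ℝ) : ℝ := if t < A then 1 - t / A else 0

lemma shrink_nonneg {t A : ℝ} (ht : 0 ≤ t) : 0 ≤ shrink t A := by
  unfold shrink
  split_ifs with h
  · rw [sub_nonneg, div_le_one (ht.trans_lt h)]
    exact h.le
  · exact le_rfl

lemma shrink_le_one {t A : ℝ} (ht : 0 ≤ t) : shrink t A ≤ 1 := by
  unfold shrink
  split_ifs with h
  · have := div_nonneg ht (ht.trans h.le)
    linarith
  · exact zero_le_one

lemma measurable_shrink (t : ℝ) : Measurable (shrink t) := by
  unfold shrink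
  exact Measurable.ite measurableSet_Ioi (by fun_prop) measurable_const

variable {Ω : Type*}

lemma regCoeff_eq (Y : ℕ → ℤ → S2 → ℂ) (β : ℕ → ℝ) (lam : ℝ) (T : Ω → S2 → ℝ) (ℓ : ℕ) (m : ℤ)
    (ω : Ω) : regCoeff Y β lam T ℓ m ω
      = (shrink (lam * β ℓ) (blockNorm Y T ℓ ω) : ℂ) * coeff Y T ℓ m ω := by
  unfold regCoeff shrink
  split_ifs <;> simp

lemma regPartialSum_eq (Y : ℕ → ℤ → S2 → ℂ) (β : ℕ → ℝ) (lam : ℝ) (T : Ω → S2 → ℝ) (N : ℕ)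
    (ω : Ω) (x : S2) : regPartialSum Y β lam T N ω x
      = ∑ ℓ ∈ Finset.range N, (shrink (lam * β ℓ) (blockNorm Y T ℓ ω) : ℂ)
        * ∑ m ∈ orders ℓ, coeff Y T ℓ m ω * Y ℓ m x := by
  simp only [regPartialSum, regCoeff_eq, Finset.mul_sum, mul_assoc]

/-- Regularization commutes with rotations. -/
lemma regPartialSum_rotate {Y : ℕ → ℤ → S2 → ℂ} (hY : IsSphericalHarmonics Y) (β : ℕ → ℝ)
    (lam : ℝ) (T : Ω → S2 → ℝ) (N : ℕ) {ω : Ω} (hT : Integrable (T ω) surf)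
    (ρ : E3 ≃ₗᵢ[ℝ] E3) (x : S2) :
    regPartialSum Y β lam T N ω (rotate ρ x)
      = regPartialSum Y β lam (fun ω y => T ω (rotate ρ y)) N ω x := by
  rw [regPartialSum_eq, regPartialSum_eq]
  have hinv : ∀ y, rotate ρ.symm (rotate ρ y) = y := fun y => by ext; simp [rotate]
  refine Finset.sum_congr rfl fun ℓ _ => ?_
  -- The coefficients of `T ∘ ρ` are those of `T` in the basis `Y ∘ ρ⁻¹`.
  have hc : ∀ m, coeff Y (fun ω y => T ω (rotate ρ y)) ℓ m ω
      = ∫ y, (T ω y : ℂ) * conj (Y ℓ m (rotate ρ.symm y)) ∂surf := by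
    intro m
    rw [← integral_comp_rotate ρ (fun y => (T ω y : ℂ) * conj (Y ℓ m (rotate ρ.symm y)))]
    simp only [hinv, coeff]
  obtain ⟨h1, h2⟩ := hY.sum_coeff_eq (Z := fun m y => Y ℓ m (rotate ρ.symm y))
    (fun m hm => comp_rotate_mem_harmonicSpace ρ.symm (hY.mem_harmonicSpace hm))
    (fun m hm m' hm' => by
      rw [integral_comp_rotate ρ.symm (fun y => Y ℓ m y * conj (Y ℓ m' y))]
      exact hY.orthonormal ℓ m hm m' hm') (f := fun y => (T ω y : ℂ)) hT.ofReal
  have h3 : blockNorm Y (fun ω y => T ω (rotate ρ y)) ℓ ω = blockNorm Y T ℓ ω := by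
    unfold blockNorm
    simp only [hc]
    exact congrArg Real.sqrt h2
  have h4 := h1 (rotate ρ x)
  simp only [hinv] at h4
  rw [h3]
  simp only [hc]
  rw [h4]
  rfl

/-- The regularized partial sums of a real field are real. -/
lemma conj_regPartialSum {Y : ℕ → ℤ → S2 → ℂ} (hY : IsSphericalHarmonics Y) (β : ℕ → ℝ)
    (lam : ℝ) (T : Ω → S2 → ℝ) (N : ℕ) {ω : Ω} (hT : Integrable (T ω) surf) (x : S2) :
    conj (regPartialSum Y β lam T N ω x) = regPartialSum Y β lam T N ω x := by
  rw [regPartialSum_eq, map_sum]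
  refine Finset.sum_congr rfl fun ℓ _ => ?_
  -- The conjugate coefficients of a real field are its coefficients in the conjugate basis.
  have hc : ∀ m, conj (coeff Y T ℓ m ω)
      = ∫ y, (T ω y : ℂ) * conj (conj (Y ℓ m y)) ∂surf := by
    intro m
    rw [coeff, ← integral_conj]
    simp
  obtain ⟨h1, -⟩ := hY.sum_coeff_eq (ℓ := ℓ) (Z := fun m y => conj (Y ℓ m y))
    (fun m hm => conj_mem_harmonicSpace (hY.mem_harmonicSpace hm))
    (fun m hm m' hm' => by
      have := congrArg conj (hY.orthonormal ℓ m hm m' hm')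
      rw [← integral_conj] at this
      simpa [apply_ite] using this) (f := fun y => (T ω y : ℂ)) hT.ofReal
  simp only [map_mul, Complex.conj_ofReal, map_sum, hc]
  rw [h1 x]
  rfl

end

/-! ### Joint laws of integrals of a random function -/

section

variable {Ω S ι : Type*} [MeasurableSpace Ω] [MeasurableSpace S]

/-- The average of `T ω · * g i` over the first `n` points of the sequence `ξ`, and `0` for
`n = 0`. -/
def empiricalMean (T : Ω → S → ℝ) (g : ι → S → ℂ) (n : ℕ) (ω : Ω) (ξ : ℕ → S) (i : ι) : ℂ :=
  (n : ℝ)⁻¹ • ∑ k ∈ Finset.range n, (T ω (ξ k) : ℂ) * g i (ξ k)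

lemma measurable_empiricalMean {T : Ω → S → ℝ} (hT : Measurable fun p : Ω × S => T p.1 p.2)
    {g : ι → S → ℂ} (hg : ∀ i, Measurable (g i)) (n : ℕ) :
    Measurable fun p : Ω × (ℕ → S) => empiricalMean T g n p.1 p.2 := by
  unfold empiricalMean
  refine measurable_pi_lambda _ fun i => Measurable.fun_const_smul
    (Finset.measurable_sum _ fun k _ => ?_) _
  have h1 : Measurable fun p : Ω × (ℕ → S) => p.2 k := (measurable_pi_apply k).comp measurable_snd
  exact (Complex.measurable_ofReal.comp (hT.comp (measurable_fst.prodMk h1))).mul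
    ((hg i).comp h1)

/-- The law of large numbers along independent points with law `μ`. -/
lemma ae_tendsto_empiricalMean [Countable ι] (μ : Measure S) [IsProbabilityMeasure μ]
    {T : Ω → S → ℝ} (hT : Measurable fun p : Ω × S => T p.1 p.2)
    {g : ι → S → ℂ} (hg : ∀ i, Measurable (g i)) {ω : Ω}
    (hω : ∀ i, Integrable (fun y => (T ω y : ℂ) * g i y) μ) :
    ∀ᵐ ξ ∂(Measure.infinitePi fun _ : ℕ => μ), Tendsto (fun n => empiricalMean T g n ω ξ) atTop
      (𝓝 fun i => ∫ y, (T ω y : ℂ) * g i y ∂μ) := by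
  simp only [tendsto_pi_nhds]
  rw [ae_all_iff]
  intro i
  set h : S → ℂ := fun y => (T ω y : ℂ) * g i y with hh
  have hm : Measurable h :=
    (Complex.measurable_ofReal.comp (hT.comp measurable_prodMk_left)).mul (hg i)
  have hpres := fun k : ℕ => measurePreserving_eval_infinitePi (fun _ : ℕ => μ) k
  have hint : Integrable (fun ξ : ℕ → S => h (ξ 0)) (Measure.infinitePi fun _ : ℕ => μ) :=
    (hpres 0).integrable_comp_of_integrable (hω i)
  have hindep := iIndepFun_infinitePi (P := fun _ : ℕ => μ) (X := fun (_ : ℕ) => h) (fun _ => hm)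
  have key := strong_law_ae (μ := Measure.infinitePi fun _ : ℕ => μ)
    (fun (k : ℕ) (ξ : ℕ → S) => h (ξ k)) hint (fun k l hkl => hindep.indepFun hkl)
    (fun k => by
      refine ⟨(hm.comp (measurable_pi_apply k)).aemeasurable,
        (hm.comp (measurable_pi_apply 0)).aemeasurable, ?_⟩
      have hk := fun k : ℕ => Measure.map_map (μ := Measure.infinitePi fun _ : ℕ => μ) hm
        (measurable_pi_apply (X := fun _ : ℕ => S) k)
      simp only [(hpres _).map_eq] at hk
      exact (hk k).symm.trans (hk 0))
  have hmean : ∫ ξ : ℕ → S, h (ξ 0) ∂(Measure.infinitePi fun _ : ℕ => μ) = ∫ y, h y ∂μ := by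
    have := integral_map (μ := Measure.infinitePi fun _ : ℕ => μ)
      (φ := fun ξ : ℕ → S => ξ 0) (hpres 0).measurable.aemeasurable
      (f := h) hm.aestronglyMeasurable
    rw [(hpres 0).map_eq] at this
    exact this.symm
  rw [hmean] at key
  filter_upwards [key] with ξ hξ
  exact hξ

open scoped BoundedContinuousFunction in
/-- The integration over `ω` is the inner one, as equality of laws is available for fixed points `ξ`;
the proof interchanges the integrals, as the law of large numbers is available for fixed `ω`. -/
lemma tendsto_integral_empiricalMean [Countable ι] (P : Measure Ω) [IsProbabilityMeasure P]
    (μ : Measure S) [IsProbabilityMeasure μ]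
    {T : Ω → S → ℝ} (hT : Measurable fun p : Ω × S => T p.1 p.2)
    {g : ι → S → ℂ} (hg : ∀ i, Measurable (g i))
    (hTg : ∀ᵐ ω ∂P, ∀ i, Integrable (fun y => (T ω y : ℂ) * g i y) μ) (f : (ι → ℂ) →ᵇ ℝ) :
    Tendsto (fun n => ∫ ξ, ∫ ω, f (empiricalMean T g n ω ξ) ∂P ∂(Measure.infinitePi fun _ : ℕ => μ))
      atTop (𝓝 (∫ ω, f (fun i => ∫ y, (T ω y : ℂ) * g i y ∂μ) ∂P)) := by
  have hm : ∀ n, Measurable fun p : Ω × (ℕ → S) => f (empiricalMean T g n p.1 p.2) := fun n =>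
    f.continuous.measurable.comp (measurable_empiricalMean hT hg n)
  have hswap : ∀ n, ∫ ξ, ∫ ω, f (empiricalMean T g n ω ξ) ∂P ∂(Measure.infinitePi fun _ : ℕ => μ)
      = ∫ ω, ∫ ξ, f (empiricalMean T g n ω ξ) ∂(Measure.infinitePi fun _ : ℕ => μ) ∂P := by
    intro n
    rw [integral_integral_swap]
    exact Integrable.of_bound ((hm n).comp measurable_swap).aestronglyMeasurable ‖f‖
      (ae_of_all _ fun _ => f.norm_coe_le_norm _)
  simp only [hswap]
  refine tendsto_integral_of_dominated_convergence (fun _ => ‖f‖) (fun n => ?_)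
    (integrable_const _) (fun n => ae_of_all _ fun ω => ?_) ?_
  · exact ((hm n).stronglyMeasurable.integral_prod_right').aestronglyMeasurable
  · refine (norm_integral_le_of_norm_le_const (ae_of_all _ fun _ => f.norm_coe_le_norm _)).trans ?_
    simp
  · filter_upwards [hTg] with ω hω
    have hlim : ∫ _ : ℕ → S, f (fun i => ∫ y, (T ω y : ℂ) * g i y ∂μ)
        ∂(Measure.infinitePi fun _ : ℕ => μ) = f (fun i => ∫ y, (T ω y : ℂ) * g i y ∂μ) := by
      simp
    rw [← hlim]
    refine tendsto_integral_of_dominated_convergence (fun _ => ‖f‖)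
      (fun n => ((hm n).comp measurable_prodMk_left).aestronglyMeasurable)
      (integrable_const _) (fun n => ae_of_all _ fun ξ => f.norm_coe_le_norm _) ?_
    filter_upwards [ae_tendsto_empiricalMean μ hT hg hω] with ξ hξ
    exact (f.continuous.tendsto _).comp hξ

lemma measurable_integral_mul (μ : Measure S) [SFinite μ] {T : Ω → S → ℝ}
    (hT : Measurable fun p : Ω × S => T p.1 p.2) {g : S → ℂ} (hg : Measurable g) :
    Measurable fun ω => ∫ y, (T ω y : ℂ) * g y ∂μ :=
  (((Complex.measurable_ofReal.comp hT).mul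
    (hg.comp measurable_snd)).stronglyMeasurable.integral_prod_right').measurable

/-- Two jointly measurable random functions with the same finite-dimensional distributions have
integrals with the same joint laws: the integrals are limits of averages over independent random
points, and these have the same law for each choice of the points. -/
theorem identDistrib_integral_mul [Countable ι] (P : Measure Ω) [IsProbabilityMeasure P]
    (μ : Measure S) [IsFiniteMeasure μ] {T T' : Ω → S → ℝ}
    (hT : Measurable fun p : Ω × S => T p.1 p.2) (hT' : Measurable fun p : Ω × S => T' p.1 p.2)
    (hTT' : ∀ (k : ℕ) (x : Fin k → S),
      IdentDistrib (fun ω i => T ω (x i)) (fun ω i => T' ω (x i)) P P)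
    {g : ι → S → ℂ} (hg : ∀ i, Measurable (g i))
    (hTg : ∀ᵐ ω ∂P, ∀ i, Integrable (fun y => (T ω y : ℂ) * g i y) μ)
    (hTg' : ∀ᵐ ω ∂P, ∀ i, Integrable (fun y => (T' ω y : ℂ) * g i y) μ) :
    IdentDistrib (fun ω i => ∫ y, (T ω y : ℂ) * g i y ∂μ)
      (fun ω i => ∫ y, (T' ω y : ℂ) * g i y ∂μ) P P := by
  rcases eq_or_ne μ 0 with rfl | hμ
  · simp only [integral_zero_measure]
    exact IdentDistrib.refl aemeasurable_const
  have : NeZero μ := ⟨hμ⟩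
  -- Points can only be drawn from a probability measure, so `μ` is normalized.
  set ν : Measure S := (μ Set.univ)⁻¹ • μ with hν
  have hνP : IsProbabilityMeasure ν := inferInstance
  have hc0 : μ Set.univ ≠ 0 := by simpa using hμ
  have hct : μ Set.univ ≠ ∞ := measure_ne_top _ _
  have hm : ∀ T : Ω → S → ℝ, (Measurable fun p : Ω × S => T p.1 p.2) →
      Measurable fun ω i => ∫ y, (T ω y : ℂ) * g i y ∂ν := fun T hT =>
    measurable_pi_lambda _ fun i => measurable_integral_mul ν hT (hg i)
  have hint : ∀ {h : S → ℂ}, Integrable h μ → Integrable h ν := fun hh =>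
    hh.smul_measure (ENNReal.inv_ne_top.mpr hc0)
  have key : IdentDistrib (fun ω i => ∫ y, (T ω y : ℂ) * g i y ∂ν)
      (fun ω i => ∫ y, (T' ω y : ℂ) * g i y ∂ν) P P := by
    refine ⟨(hm T hT).aemeasurable, (hm T' hT').aemeasurable, ?_⟩
    have := Measure.isProbabilityMeasure_map (μ := P) (hm T hT).aemeasurable
    have := Measure.isProbabilityMeasure_map (μ := P) (hm T' hT').aemeasurable
    refine ext_of_forall_integral_eq_of_IsFiniteMeasure fun f => ?_
    rw [integral_map (hm T hT).aemeasurable f.continuous.measurable.aestronglyMeasurable,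
      integral_map (hm T' hT').aemeasurable f.continuous.measurable.aestronglyMeasurable]
    have h1 := tendsto_integral_empiricalMean P ν hT hg
      (hTg.mono fun ω hω i => hint (hω i)) f
    have h2 := tendsto_integral_empiricalMean P ν hT' hg
      (hTg'.mono fun ω hω i => hint (hω i)) f
    refine tendsto_nhds_unique h1 (h2.congr fun n => integral_congr_ae (ae_of_all _ fun ξ => ?_))
    -- For fixed points `ξ`, the average is a measurable function of the values at these points.
    set Φ : (Fin n → ℝ) → ι → ℂ := fun v i =>
      (n : ℝ)⁻¹ • ∑ k : Fin n, (v k : ℂ) * g i (ξ k) with hΦ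
    have hΦm : Measurable Φ := by
      refine measurable_pi_lambda _ fun i => Measurable.fun_const_smul
        (Finset.measurable_sum _ fun k _ => ?_) _
      exact (Complex.measurable_ofReal.comp (measurable_pi_apply k)).mul_const _
    have hΦ' : ∀ (T : Ω → S → ℝ) ω, empiricalMean T g n ω ξ = Φ fun k => T ω (ξ k) := by
      intro T ω
      ext i
      simp only [empiricalMean, hΦ, Finset.sum_range]
    simp only [hΦ']
    exact ((hTT' n fun k => ξ k).symm.comp (f.continuous.measurable.comp hΦm)).integral_eq
  have hscale : ∀ T : Ω → S → ℝ, (fun ω i => ∫ y, (T ω y : ℂ) * g i y ∂μ)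
      = (fun v : ι → ℂ => (μ Set.univ).toReal • v) ∘
        fun ω i => ∫ y, (T ω y : ℂ) * g i y ∂ν := by
    intro T
    ext ω i
    have h0 : (μ Set.univ).toReal ≠ 0 := ENNReal.toReal_ne_zero.mpr ⟨hc0, hct⟩
    simp only [Function.comp, Pi.smul_apply, hν, integral_smul_measure, ENNReal.toReal_inv]
    rw [smul_inv_smul₀ h0]
  rw [hscale T, hscale T']
  exact key.comp (measurable_pi_lambda _ fun i => (measurable_pi_apply i).const_smul _)

end

/-! ### Parseval and Bessel estimates -/

section

lemma eLpNorm_two_sq {α F : Type*} [MeasurableSpace α] [NormedAddCommGroup F] (f : α → F)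
    (μ : Measure α) : eLpNorm f 2 μ ^ 2 = ∫⁻ x, ‖f x‖ₑ ^ 2 ∂μ := by
  have := eLpNorm_nnreal_pow_eq_lintegral (μ := μ) (f := f) (p := 2) two_ne_zero
  simpa using this

/-- The pairs of a degree and an order belonging to it. -/
abbrev HarmonicIndex : Type := Σ ℓ : ℕ, orders ℓ

lemma IsSphericalHarmonics.memLp {Y : ℕ → ℤ → S2 → ℂ} (hY : IsSphericalHarmonics Y)
    (i : HarmonicIndex) : MemLp (Y i.1 i.2) 2 surf := by
  have hc := hY.continuous i.2.2
  obtain ⟨C, hC⟩ := IsCompact.exists_bound_of_continuousOn isCompact_univ hc.continuousOn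
  exact MemLp.of_bound hc.aestronglyMeasurable C (ae_of_all _ fun x => hC x trivial)

lemma inner_toLp_toLp {f g : S2 → ℂ} (hf : MemLp f 2 surf) (hg : MemLp g 2 surf) :
    inner ℂ (hf.toLp f) (hg.toLp g) = ∫ x, g x * conj (f x) ∂surf := by
  rw [L2.inner_def]
  refine integral_congr_ae ?_
  filter_upwards [hf.coeFn_toLp, hg.coeFn_toLp] with x h1 h2
  rw [h1, h2, RCLike.inner_apply]

lemma IsSphericalHarmonics.orthonormal_toLp {Y : ℕ → ℤ → S2 → ℂ} (hY : IsSphericalHarmonics Y) :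
    Orthonormal ℂ fun i : HarmonicIndex => (hY.memLp i).toLp (Y i.1 i.2) := by
  rw [orthonormal_iff_ite]
  rintro ⟨ℓ, m⟩ ⟨ℓ', m'⟩
  rw [inner_toLp_toLp, hY.integral_mul_conj m'.2 m.2]
  by_cases h : ℓ = ℓ'
  · subst h
    refine if_congr ?_ rfl rfl
    simp only [true_and, Sigma.mk.injEq, heq_eq_eq, Subtype.ext_iff]
    exact eq_comm
  · rw [if_neg (fun h' => h h'.1.symm), if_neg (fun h' => h (Sigma.mk.inj h').1)]

lemma sum_orders (ℓ : ℕ) {M : Type*} [AddCommMonoid M] (f : ℤ → M) :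
    ∑ m ∈ orders ℓ, f m = ∑ m : orders ℓ, f m := (Finset.sum_coe_sort _ _).symm

/-- The Parseval identity for a finite combination of spherical harmonics. -/
lemma IsSphericalHarmonics.eLpNorm_sum_sq {Y : ℕ → ℤ → S2 → ℂ} (hY : IsSphericalHarmonics Y)
    (s : Finset ℕ) (b : ℕ → ℤ → ℂ) :
    eLpNorm (fun x => ∑ ℓ ∈ s, ∑ m ∈ orders ℓ, b ℓ m * Y ℓ m x) 2 surf ^ 2
      = ∑ ℓ ∈ s, ENNReal.ofReal (∑ m ∈ orders ℓ, ‖b ℓ m‖ ^ 2) := by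
  classical
  set t : Finset HarmonicIndex := s.sigma fun ℓ => (Finset.univ : Finset (orders ℓ)) with ht
  set e : HarmonicIndex → Lp ℂ 2 surf := fun i => (hY.memLp i).toLp (Y i.1 i.2) with he
  have hae : (fun x => ∑ ℓ ∈ s, ∑ m ∈ orders ℓ, b ℓ m * Y ℓ m x)
      =ᵐ[surf] (∑ i ∈ t, b i.1 i.2 • e i : Lp ℂ 2 surf) := by
    have h1 : (∑ i ∈ t, b i.1 i.2 • e i : Lp ℂ 2 surf)
        =ᵐ[surf] ∑ i ∈ t, ⇑(b i.1 i.2 • e i) := by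
      exact Lp.coeFn_finsetSum _ _
    have h2 : ∀ᵐ x ∂surf, ∀ i ∈ t, (b i.1 i.2 • e i : Lp ℂ 2 surf) x = b i.1 i.2 * Y i.1 i.2 x := by
      rw [eventually_all_finset]
      intro i _
      filter_upwards [Lp.coeFn_smul (b i.1 i.2) (e i), (hY.memLp i).coeFn_toLp] with x hx hx'
      rw [hx, Pi.smul_apply, hx', smul_eq_mul]
    filter_upwards [h1, h2] with x hx hx'
    rw [hx, Finset.sum_apply, Finset.sum_congr rfl hx', ht, Finset.sum_sigma]
    exact Finset.sum_congr rfl fun ℓ _ => sum_orders ℓ _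
  rw [eLpNorm_congr_ae hae, ← Lp.enorm_def, ← ofReal_norm, ← ENNReal.ofReal_pow (norm_nonneg _)]
  have h3 : ‖∑ i ∈ t, b i.1 i.2 • e i‖ ^ 2 = ∑ ℓ ∈ s, ∑ m ∈ orders ℓ, ‖b ℓ m‖ ^ 2 := by
    have h4 := hY.orthonormal_toLp.inner_sum (fun i => b i.1 i.2) (fun i => b i.1 i.2) t
    rw [inner_self_eq_norm_sq_to_K] at h4
    apply Complex.ofReal_injective
    push_cast
    refine h4.trans ?_
    rw [ht, Finset.sum_sigma]
    refine Finset.sum_congr rfl fun ℓ _ => ?_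
    rw [sum_orders]
    exact Finset.sum_congr rfl fun _ _ => by rw [Complex.conj_mul']
  rw [h3, ENNReal.ofReal_sum_of_nonneg fun ℓ _ => Finset.sum_nonneg fun _ _ => sq_nonneg _]

variable {Ω : Type*}

lemma blockNorm_sq (Y : ℕ → ℤ → S2 → ℂ) (T : Ω → S2 → ℝ) (ℓ : ℕ) (ω : Ω) :
    blockNorm Y T ℓ ω ^ 2 = ∑ m ∈ orders ℓ, ‖coeff Y T ℓ m ω‖ ^ 2 :=
  Real.sq_sqrt (Finset.sum_nonneg fun _ _ => sq_nonneg _)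

/-- Bessel's inequality for a single realization. -/
lemma IsSphericalHarmonics.sum_blockNorm_sq_le {Y : ℕ → ℤ → S2 → ℂ} (hY : IsSphericalHarmonics Y)
    {T : Ω → S2 → ℝ} {ω : Ω} (hT : MemLp (T ω) 2 surf) (N : ℕ) :
    ∑ ℓ ∈ Finset.range N, ENNReal.ofReal (blockNorm Y T ℓ ω ^ 2) ≤ ∫⁻ x, ‖T ω x‖ₑ ^ 2 ∂surf := by
  have hT' : MemLp (fun x => (T ω x : ℂ)) 2 surf := hT.ofReal
  have h := hY.orthonormal_toLp.sum_inner_products_le (hT'.toLp _)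
    (s := (Finset.range N).sigma fun ℓ => (Finset.univ : Finset (orders ℓ)))
  rw [Finset.sum_sigma] at h
  simp only [inner_toLp_toLp] at h
  rw [← ENNReal.ofReal_sum_of_nonneg fun ℓ _ => sq_nonneg _]
  have h2 : ∫⁻ x, ‖T ω x‖ₑ ^ 2 ∂surf = ENNReal.ofReal (‖hT'.toLp _‖ ^ 2) := by
    rw [ENNReal.ofReal_pow (norm_nonneg _), ofReal_norm, Lp.enorm_toLp, eLpNorm_two_sq]
    simp [enorm_eq_nnnorm]
  rw [h2]
  refine ENNReal.ofReal_le_ofReal (le_trans (le_of_eq ?_) h)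
  refine Finset.sum_congr rfl fun ℓ _ => ?_
  rw [blockNorm_sq, sum_orders]
  rfl

lemma regPartialSum_sub (Y : ℕ → ℤ → S2 → ℂ) (β : ℕ → ℝ) (lam : ℝ) (T : Ω → S2 → ℝ) {M N : ℕ}
    (h : M ≤ N) (ω : Ω) (x : S2) :
    regPartialSum Y β lam T N ω x - regPartialSum Y β lam T M ω x
      = ∑ ℓ ∈ Finset.Ico M N, ∑ m ∈ orders ℓ, regCoeff Y β lam T ℓ m ω * Y ℓ m x := by
  rw [Finset.sum_Ico_eq_sub _ h]
  rfl

lemma sum_norm_regCoeff_sq_le (Y : ℕ → ℤ → S2 → ℂ) {β : ℕ → ℝ} (hβ : ∀ ℓ, 0 < β ℓ) {lam : ℝ}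
    (hlam : 0 ≤ lam) (T : Ω → S2 → ℝ) (ℓ : ℕ) (ω : Ω) :
    ∑ m ∈ orders ℓ, ‖regCoeff Y β lam T ℓ m ω‖ ^ 2 ≤ blockNorm Y T ℓ ω ^ 2 := by
  have ht : 0 ≤ lam * β ℓ := mul_nonneg hlam (hβ ℓ).le
  rw [blockNorm_sq]
  refine Finset.sum_le_sum fun m _ => ?_
  rw [regCoeff_eq, norm_mul, Complex.norm_real, Real.norm_of_nonneg (shrink_nonneg ht)]
  exact pow_le_pow_left₀ (mul_nonneg (shrink_nonneg ht) (norm_nonneg _))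
    (mul_le_of_le_one_left (norm_nonneg _) (shrink_le_one ht)) 2

lemma eLpNorm_regPartialSum_sub_sq_le {Y : ℕ → ℤ → S2 → ℂ} (hY : IsSphericalHarmonics Y)
    {β : ℕ → ℝ} (hβ : ∀ ℓ, 0 < β ℓ) {lam : ℝ} (hlam : 0 ≤ lam) (T : Ω → S2 → ℝ) {M N : ℕ}
    (h : M ≤ N) (ω : Ω) :
    eLpNorm (fun x => regPartialSum Y β lam T N ω x - regPartialSum Y β lam T M ω x) 2 surf ^ 2
      ≤ ∑ ℓ ∈ Finset.Ico M N, ENNReal.ofReal (blockNorm Y T ℓ ω ^ 2) := by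
  simp only [regPartialSum_sub Y β lam T h]
  rw [hY.eLpNorm_sum_sq]
  exact Finset.sum_le_sum fun ℓ _ =>
    ENNReal.ofReal_le_ofReal (sum_norm_regCoeff_sq_le Y hβ hlam T ℓ ω)

/-- The partial sum of the regularized expansion as a function of the coefficients, on which the
shrinkage factors depend as well. -/
def synthesis (Y : ℕ → ℤ → S2 → ℂ) (β : ℕ → ℝ) (lam : ℝ) (N : ℕ) (x : S2)
    (c : HarmonicIndex → ℂ) : ℂ :=
  ∑ ℓ ∈ Finset.range N, (shrink (lam * β ℓ) (Real.sqrt (∑ m : orders ℓ, ‖c ⟨ℓ, m⟩‖ ^ 2)) : ℂ)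
    * ∑ m : orders ℓ, c ⟨ℓ, m⟩ * Y ℓ m x

lemma measurable_synthesis (Y : ℕ → ℤ → S2 → ℂ) (β : ℕ → ℝ) (lam : ℝ) (N : ℕ) (x : S2) :
    Measurable (synthesis Y β lam N x) := by
  unfold synthesis
  refine Finset.measurable_fun_sum _ fun ℓ _ => Measurable.mul ?_
    (Finset.measurable_fun_sum _ fun m hm => Measurable.mul_const (measurable_pi_apply _) _)
  exact Complex.measurable_ofReal.comp ((measurable_shrink _).comp
    (Finset.measurable_fun_sum _ fun m _ => (measurable_pi_apply _).norm.pow_const 2).sqrt)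

lemma regPartialSum_eq_synthesis (Y : ℕ → ℤ → S2 → ℂ) (β : ℕ → ℝ) (lam : ℝ) (T : Ω → S2 → ℝ)
    (N : ℕ) (ω : Ω) (x : S2) : regPartialSum Y β lam T N ω x
      = synthesis Y β lam N x fun i => coeff Y T i.1 i.2 ω := by
  simp only [regPartialSum_eq, synthesis, blockNorm, sum_orders]

variable [MeasurableSpace Ω]

lemma IsRandomField.ae_memLp {P : Measure Ω} [IsProbabilityMeasure P] {T : Ω → S2 → ℝ}
    (hT : IsRandomField P T) : ∀ᵐ ω ∂P, MemLp (T ω) 2 surf := by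
  have h :=
    ((memLp_two_iff_integrable_sq hT.measurable.aestronglyMeasurable).1 hT.memLp).prod_right_ae
  filter_upwards [h] with ω hω
  exact (memLp_two_iff_integrable_sq
    (hT.measurable.comp measurable_prodMk_left).aestronglyMeasurable).2 hω

lemma IsRandomField.ae_integrable {P : Measure Ω} [IsProbabilityMeasure P] {T : Ω → S2 → ℝ}
    (hT : IsRandomField P T) : ∀ᵐ ω ∂P, Integrable (T ω) surf := by
  filter_upwards [hT.ae_memLp] with ω hω
  exact hω.integrable one_le_two

lemma measurable_coeff {Y : ℕ → ℤ → S2 → ℂ} (hY : IsSphericalHarmonics Y) {T : Ω → S2 → ℝ}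
    (hT : Measurable fun p : Ω × S2 => T p.1 p.2) {ℓ : ℕ} {m : ℤ} (hm : m ∈ orders ℓ) :
    Measurable (coeff Y T ℓ m) :=
  measurable_integral_mul surf hT (Complex.continuous_conj.comp (hY.continuous hm)).measurable

lemma measurable_blockNorm {Y : ℕ → ℤ → S2 → ℂ} (hY : IsSphericalHarmonics Y) {T : Ω → S2 → ℝ}
    (hT : Measurable fun p : Ω × S2 => T p.1 p.2) (ℓ : ℕ) : Measurable (blockNorm Y T ℓ) :=
  (Finset.measurable_fun_sum _ fun _ hm => (measurable_coeff hY hT hm).norm.pow_const 2).sqrt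

lemma measurable_regPartialSum {Y : ℕ → ℤ → S2 → ℂ} (hY : IsSphericalHarmonics Y) (β : ℕ → ℝ)
    (lam : ℝ) {T : Ω → S2 → ℝ} (hT : Measurable fun p : Ω × S2 => T p.1 p.2) (N : ℕ) :
    Measurable fun p : Ω × S2 => regPartialSum Y β lam T N p.1 p.2 := by
  simp only [regPartialSum_eq]
  refine Finset.measurable_fun_sum _ fun ℓ _ => Measurable.mul ?_
    (Finset.measurable_fun_sum _ fun m hm => Measurable.mul ?_ ?_)
  · exact Complex.measurable_ofReal.comp ((measurable_shrink _).comp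
      ((measurable_blockNorm hY hT ℓ).comp measurable_fst))
  · exact (measurable_coeff hY hT hm).comp measurable_fst
  · exact (hY.continuous hm).measurable.comp measurable_snd

/-- The joint law of the values of regularized partial sums at finitely many points is invariant
under rotations. -/
lemma identDistrib_regPartialSum {P : Measure Ω} [IsProbabilityMeasure P]
    {Y : ℕ → ℤ → S2 → ℂ} (hY : IsSphericalHarmonics Y) (β : ℕ → ℝ) (lam : ℝ) {T : Ω → S2 → ℝ}
    (hT : IsRandomField P T) (hiso : StronglyIsotropic P T) {ρ : E3 ≃ₗᵢ[ℝ] E3}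
    (hρ : IsRotation ρ) {κ : Type*} [Countable κ] (N : κ → ℕ) (x : κ → S2) :
    IdentDistrib (fun ω k => regPartialSum Y β lam T (N k) ω (x k))
      (fun ω k => regPartialSum Y β lam T (N k) ω (rotate ρ (x k))) P P := by
  set T' : Ω → S2 → ℝ := fun ω y => T ω (rotate ρ y) with hT'
  have hT'm : Measurable fun p : Ω × S2 => T' p.1 p.2 :=
    hT.measurable.comp (measurable_fst.prodMk ((measurable_rotate ρ).comp measurable_snd))
  have hint : ∀ {f : S2 → ℝ}, Integrable f surf → ∀ i : HarmonicIndex,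
      Integrable (fun y => (f y : ℂ) * conj (Y i.1 i.2 y)) surf := fun hf i =>
    integrable_mul_of_continuous hf.ofReal
      (Complex.continuous_conj.comp (hY.continuous i.2.2))
  have h1 := identDistrib_integral_mul P surf hT.measurable hT'm
    (fun k z => hiso k z ρ hρ) (g := fun (i : HarmonicIndex) y => conj (Y i.1 i.2 y))
    (fun i => (Complex.continuous_conj.comp (hY.continuous i.2.2)).measurable)
    (hT.ae_integrable.mono fun ω hω => hint hω)
    (hT.ae_integrable.mono fun ω hω => hint
      ((measurePreserving_rotate ρ).integrable_comp_of_integrable hω))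
  have h2 := h1.comp (measurable_pi_lambda _ fun k => measurable_synthesis Y β lam (N k) (x k))
  have h3 : ∀ S : Ω → S2 → ℝ, (fun ω k => regPartialSum Y β lam S (N k) ω (x k))
      = (fun c k => synthesis Y β lam (N k) (x k) c) ∘
        fun ω (i : HarmonicIndex) => ∫ y, (S ω y : ℂ) * conj (Y i.1 i.2 y) ∂surf := by
    intro S
    ext ω k
    exact regPartialSum_eq_synthesis Y β lam S (N k) ω (x k)
  rw [← h3, ← h3] at h2
  refine h2.trans (IdentDistrib.of_ae_eq h2.aemeasurable_snd ?_)
  filter_upwards [hT.ae_integrable] with ω hω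
  ext k
  exact (regPartialSum_rotate hY β lam T (N k) hω ρ (x k)).symm

/-- The mean square of the coefficient vector of degree `ℓ`. -/
def meanPower (P : Measure Ω) (Y : ℕ → ℤ → S2 → ℂ) (T : Ω → S2 → ℝ) (ℓ : ℕ) : ℝ≥0∞ :=
  ∫⁻ ω, ENNReal.ofReal (blockNorm Y T ℓ ω ^ 2) ∂P

/-- Bessel's inequality in the mean: the total power is finite. -/
lemma tsum_meanPower_ne_top {P : Measure Ω} [IsProbabilityMeasure P] {Y : ℕ → ℤ → S2 → ℂ}
    (hY : IsSphericalHarmonics Y) {T : Ω → S2 → ℝ} (hT : IsRandomField P T) :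
    ∑' ℓ, meanPower P Y T ℓ ≠ ∞ := by
  have hle : ∑' ℓ, meanPower P Y T ℓ
      ≤ eLpNorm (fun p : Ω × S2 => T p.1 p.2) 2 (P.prod surf) ^ 2 := by
    refine ENNReal.tsum_le_of_sum_range_le fun N => ?_
    unfold meanPower
    rw [← lintegral_finsetSum _ fun ℓ _ =>
      ((measurable_blockNorm hY hT.measurable ℓ).pow_const 2).ennreal_ofReal, eLpNorm_two_sq,
      lintegral_prod _ (hT.measurable.enorm.pow_const 2).aemeasurable]
    refine lintegral_mono_ae ?_
    filter_upwards [hT.ae_memLp] with ω hω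
    exact hY.sum_blockNorm_sq_le hω N
  exact ne_top_of_le_ne_top (ENNReal.pow_ne_top hT.memLp.eLpNorm_ne_top) hle

/-- At every point of the sphere the partial sums are Cauchy in mean square, uniformly in the
point: by isotropy, the mean square of an increment does not depend on the point, and so it is its
own average over the sphere. -/
lemma eLpNorm_regPartialSum_sub_le {P : Measure Ω} [IsProbabilityMeasure P]
    {Y : ℕ → ℤ → S2 → ℂ} (hY : IsSphericalHarmonics Y) {β : ℕ → ℝ} (hβ : ∀ ℓ, 0 < β ℓ) {lam : ℝ}
    (hlam : 0 ≤ lam) {T : Ω → S2 → ℝ} (hT : IsRandomField P T) (hiso : StronglyIsotropic P T)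
    {K M N : ℕ} (hM : K ≤ M) (hN : K ≤ N) (x : S2) :
    eLpNorm (fun ω => regPartialSum Y β lam T N ω x - regPartialSum Y β lam T M ω x) 2 P ^ 2
      * surf Set.univ ≤ ∑' ℓ, meanPower P Y T (ℓ + K) := by
  wlog h : M ≤ N generalizing M N
  · have := this hN hM (le_of_not_ge h)
    have hcomm := eLpNorm_sub_comm (fun ω => regPartialSum Y β lam T N ω x)
      (fun ω => regPartialSum Y β lam T M ω x) 2 P
    simp only [Pi.sub_def] at hcomm
    rwa [hcomm]
  set D : S2 → ℝ≥0∞ := fun x =>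
    eLpNorm (fun ω => regPartialSum Y β lam T N ω x - regPartialSum Y β lam T M ω x) 2 P with hD
  have hconst : ∀ y, D x = D y := by
    intro y
    obtain ⟨ρ, hρ, rfl⟩ := exists_isRotation_rotate_eq x y
    have h1 := identDistrib_regPartialSum hY β lam hT hiso hρ
      (fun b : Bool => if b then N else M) (fun _ => x)
    have h2 := (h1.comp (u := fun v : Bool → ℂ => v true - v false)
      ((measurable_pi_apply true).sub (measurable_pi_apply false))).eLpNorm_eq 2
    simpa [Function.comp_def] using h2
  have hmeas : Measurable fun p : Ω × S2 =>
      ‖regPartialSum Y β lam T N p.1 p.2 - regPartialSum Y β lam T M p.1 p.2‖ₑ ^ 2 :=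
    ((measurable_regPartialSum hY β lam hT.measurable N).sub
      (measurable_regPartialSum hY β lam hT.measurable M)).enorm.pow_const 2
  calc D x ^ 2 * surf Set.univ = ∫⁻ y, D y ^ 2 ∂surf := by
        simp only [← hconst, lintegral_const]
    _ = ∫⁻ ω, ∫⁻ y, ‖regPartialSum Y β lam T N ω y
          - regPartialSum Y β lam T M ω y‖ₑ ^ 2 ∂surf ∂P := by
        simp only [hD, eLpNorm_two_sq]
        rw [lintegral_lintegral_swap]
        exact (hmeas.comp measurable_swap).aemeasurable
    _ ≤ ∫⁻ ω, ∑ ℓ ∈ Finset.Ico M N, ENNReal.ofReal (blockNorm Y T ℓ ω ^ 2) ∂P := by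
        refine lintegral_mono fun ω => ?_
        rw [← eLpNorm_two_sq]
        exact eLpNorm_regPartialSum_sub_sq_le hY hβ hlam T h ω
    _ = ∑ ℓ ∈ Finset.Ico M N, meanPower P Y T ℓ :=
        lintegral_finsetSum _ fun ℓ _ =>
          ((measurable_blockNorm hY hT.measurable ℓ).pow_const 2).ennreal_ofReal
    _ = ∑ j ∈ Finset.Ico (M - K) (N - K), meanPower P Y T (j + K) := by
        rw [Finset.sum_Ico_add', Nat.sub_add_cancel hM, Nat.sub_add_cancel hN]
    _ ≤ ∑' ℓ, meanPower P Y T (ℓ + K) := ENNReal.sum_le_tsum _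

end

/-! ### Existence and isotropy of the regularized field -/

section

variable {Ω : Type*} [MeasurableSpace Ω]

lemma tendsto_zero_of_sq_le {u v : ℕ → ℝ≥0∞} (huv : ∀ n, u n ^ 2 ≤ v n)
    (hv : Tendsto v atTop (𝓝 0)) : Tendsto u atTop (𝓝 0) := by
  have h1 : Tendsto (fun n => (v n) ^ (2 : ℝ)⁻¹) atTop (𝓝 0) := by
    have := (ENNReal.continuous_rpow_const (y := (2 : ℝ)⁻¹)).tendsto 0
    rw [ENNReal.zero_rpow_of_pos (by norm_num)] at this
    exact this.comp hv
  refine tendsto_of_tendsto_of_tendsto_of_le_of_le tendsto_const_nhds h1 (fun _ => zero_le) ?_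
  intro n
  change u n ≤ _
  rw [ENNReal.le_rpow_inv_iff (by norm_num)]
  exact_mod_cast huv n

/-- A common bound for the mean square distance, at each point of the sphere, of the partial
sums with at least `K` degrees. -/
def tailBound (P : Measure Ω) (Y : ℕ → ℤ → S2 → ℂ) (T : Ω → S2 → ℝ) (K : ℕ) : ℝ≥0∞ :=
  (∑' ℓ, meanPower P Y T (ℓ + K)) / surf Set.univ

lemma tailBound_ne_top {P : Measure Ω} [IsProbabilityMeasure P] {Y : ℕ → ℤ → S2 → ℂ}
    (hY : IsSphericalHarmonics Y) {T : Ω → S2 → ℝ} (hT : IsRandomField P T) (K : ℕ) :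
    tailBound P Y T K ≠ ∞ :=
  ENNReal.div_ne_top (ne_top_of_le_ne_top (tsum_meanPower_ne_top hY hT)
    (ENNReal.tsum_comp_le_tsum_of_injective (add_left_injective K) _)) surf_univ_ne_zero

lemma tendsto_tailBound {P : Measure Ω} [IsProbabilityMeasure P] {Y : ℕ → ℤ → S2 → ℂ}
    (hY : IsSphericalHarmonics Y) {T : Ω → S2 → ℝ} (hT : IsRandomField P T) :
    Tendsto (tailBound P Y T) atTop (𝓝 0) := by
  have h := ENNReal.Tendsto.div_const
    (ENNReal.tendsto_sum_nat_add _ (tsum_meanPower_ne_top hY hT)) (b := surf Set.univ)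
    (Or.inr surf_univ_ne_zero)
  rwa [ENNReal.zero_div] at h

lemma eLpNorm_regPartialSum_sub_le_tailBound {P : Measure Ω} [IsProbabilityMeasure P]
    {Y : ℕ → ℤ → S2 → ℂ} (hY : IsSphericalHarmonics Y) {β : ℕ → ℝ} (hβ : ∀ ℓ, 0 < β ℓ) {lam : ℝ}
    (hlam : 0 ≤ lam) {T : Ω → S2 → ℝ} (hT : IsRandomField P T) (hiso : StronglyIsotropic P T)
    {K M N : ℕ} (hM : K ≤ M) (hN : K ≤ N) (x : S2) :
    eLpNorm (fun ω => regPartialSum Y β lam T N ω x - regPartialSum Y β lam T M ω x) 2 P ^ 2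
      ≤ tailBound P Y T K := by
  unfold tailBound
  rw [ENNReal.le_div_iff_mul_le (Or.inl surf_univ_ne_zero) (Or.inl (measure_ne_top _ _))]
  exact eLpNorm_regPartialSum_sub_le hY hβ hlam hT hiso hM hN x

lemma measurable_regPartialSum_apply {Y : ℕ → ℤ → S2 → ℂ} (hY : IsSphericalHarmonics Y)
    (β : ℕ → ℝ) (lam : ℝ) {T : Ω → S2 → ℝ} (hT : Measurable fun p : Ω × S2 => T p.1 p.2) (N : ℕ)
    (x : S2) : Measurable fun ω => regPartialSum Y β lam T N ω x :=
  Measurable.comp (g := fun p : Ω × S2 => regPartialSum Y β lam T N p.1 p.2)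
    (f := fun ω => (ω, x)) (measurable_regPartialSum hY β lam hT N) measurable_prodMk_right

/-- A jointly measurable field to which the partial sums converge in mean square at every point,
uniformly in the point: the pointwise limit along a subsequence that converges so fast that, at
each point, it converges almost surely. -/
lemma exists_limit_field {P : Measure Ω} [IsProbabilityMeasure P]
    {Y : ℕ → ℤ → S2 → ℂ} (hY : IsSphericalHarmonics Y) {β : ℕ → ℝ} (hβ : ∀ ℓ, 0 < β ℓ) {lam : ℝ}
    (hlam : 0 ≤ lam) {T : Ω → S2 → ℝ} (hT : IsRandomField P T) (hiso : StronglyIsotropic P T) :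
    ∃ Tr : Ω → S2 → ℝ, (Measurable fun p : Ω × S2 => Tr p.1 p.2) ∧
      ∀ N x, eLpNorm (fun ω => (Tr ω x : ℂ) - regPartialSum Y β lam T N ω x) 2 P ^ 2
        ≤ tailBound P Y T N := by
  obtain ⟨φ, hφ, hφB⟩ := extraction_forall_of_eventually
    (P := fun k n => tailBound P Y T n < (((1 / 2 : ℝ≥0∞)) ^ k) ^ 2) fun k =>
      (tendsto_tailBound hY hT).eventually_lt_const
        (ENNReal.pow_pos (ENNReal.pow_pos (by simp) k) 2)
  have hmeas := fun n => measurable_regPartialSum hY β lam hT.measurable n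
  have hmeasx := fun n x => measurable_regPartialSum_apply hY β lam hT.measurable n x
  -- Where the real parts fail to converge, the value of the upper limit is irrelevant.
  refine ⟨fun ω x => limsup (fun k => (regPartialSum Y β lam T (φ k) ω x).re) atTop,
    Measurable.limsup fun k => Complex.measurable_re.comp (hmeas (φ k)), fun N x => ?_⟩
  have hlim : ∀ᵐ ω ∂P, ∃ l, Tendsto (fun k => regPartialSum Y β lam T (φ k) ω x) atTop (𝓝 l) := by
    refine Lp.ae_tendsto_of_cauchy_eLpNorm (p := 2)
      (f := fun k ω => regPartialSum Y β lam T (φ k) ω x)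
      (fun k => (hmeasx (φ k) x).aestronglyMeasurable) one_le_two
      (B := fun k => (1 / 2 : ℝ≥0∞) ^ k) ?_ fun K n m hn hm => ?_
    · rw [ENNReal.tsum_geometric]
      simp
    · have h := (eLpNorm_regPartialSum_sub_le_tailBound hY hβ hlam hT hiso
        (hφ.monotone hm) (hφ.monotone hn) x).trans_lt (hφB K)
      exact lt_of_pow_lt_pow_left' 2 h
  have hlim' : ∀ᵐ ω ∂P, Tendsto (fun k => regPartialSum Y β lam T (φ k) ω x
      - regPartialSum Y β lam T N ω x) atTop
      (𝓝 (((limsup (fun k => (regPartialSum Y β lam T (φ k) ω x).re) atTop : ℝ) : ℂ)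
        - regPartialSum Y β lam T N ω x)) := by
    filter_upwards [hlim, hT.ae_integrable] with ω ⟨l, hl⟩ hω
    refine Tendsto.sub_const ?_ _
    have hre : ∀ n, regPartialSum Y β lam T n ω x = ((regPartialSum Y β lam T n ω x).re : ℂ) :=
      fun n => (Complex.conj_eq_iff_re.1 (conj_regPartialSum hY β lam T n hω x)).symm
    have h1 := (Complex.continuous_re.tendsto l).comp hl
    have h2 : limsup (fun k => (regPartialSum Y β lam T (φ k) ω x).re) atTop = l.re :=
      h1.limsup_eq
    rw [h2]
    refine ((Complex.continuous_ofReal.tendsto l.re).comp h1).congr fun k => ?_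
    exact (hre (φ k)).symm
  -- Fatou's lemma carries the bound over to the limit.
  have hfatou := Lp.eLpNorm_lim_le_liminf_eLpNorm (p := 2) (μ := P)
    (fun k => ((hmeasx (φ k) x).sub (hmeasx N x)).aestronglyMeasurable) _ hlim'
  have hbound : atTop.liminf (fun k => eLpNorm ((fun ω => regPartialSum Y β lam T (φ k) ω x)
      - fun ω => regPartialSum Y β lam T N ω x) 2 P) ≤ (tailBound P Y T N) ^ (2 : ℝ)⁻¹ := by
    refine liminf_le_of_frequently_le' (Eventually.frequently ?_)
    filter_upwards [eventually_ge_atTop N] with k hk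
    rw [ENNReal.le_rpow_inv_iff (by norm_num)]
    exact_mod_cast eLpNorm_regPartialSum_sub_le_tailBound hY hβ hlam hT hiso le_rfl
      (hk.trans hφ.le_apply) x
  have := hfatou.trans hbound
  rw [ENNReal.le_rpow_inv_iff (by norm_num)] at this
  exact_mod_cast this

lemma exists_isRegularizedField {P : Measure Ω} [IsProbabilityMeasure P]
    {Y : ℕ → ℤ → S2 → ℂ} (hY : IsSphericalHarmonics Y) {β : ℕ → ℝ} (hβ : ∀ ℓ, 0 < β ℓ) {lam : ℝ}
    (hlam : 0 ≤ lam) {T : Ω → S2 → ℝ} (hT : IsRandomField P T) (hiso : StronglyIsotropic P T) :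
    ∃ Tr : Ω → S2 → ℝ, IsRegularizedField P Y β lam T Tr := by
  obtain ⟨Tr, hTr, hTrN⟩ := exists_limit_field hY hβ hlam hT hiso
  have hprod : ∀ N, eLpNorm (fun p : Ω × S2 => (Tr p.1 p.2 : ℂ)
      - regPartialSum Y β lam T N p.1 p.2) 2 (P.prod surf) ^ 2
      ≤ tailBound P Y T N * surf Set.univ := by
    intro N
    have hm : Measurable fun p : Ω × S2 => ‖(Tr p.1 p.2 : ℂ)
        - regPartialSum Y β lam T N p.1 p.2‖ₑ ^ 2 :=
      ((Complex.measurable_ofReal.comp hTr).sub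
        (measurable_regPartialSum hY β lam hT.measurable N)).enorm.pow_const 2
    rw [eLpNorm_two_sq, lintegral_prod_symm _ hm.aemeasurable, ← lintegral_const]
    refine lintegral_mono fun x => ?_
    rw [← eLpNorm_two_sq (fun ω => (Tr ω x : ℂ) - regPartialSum Y β lam T N ω x)]
    exact hTrN N x
  refine ⟨Tr, ⟨hTr, hTr.aestronglyMeasurable, ?_⟩, ?_, fun x => ?_⟩
  · have h0 := hprod 0
    -- The empty partial sum vanishes, so the bound for `N = 0` is one for the field itself.
    simp only [regPartialSum, Finset.range_zero, Finset.sum_empty, sub_zero] at h0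
    have h1 : eLpNorm (fun p : Ω × S2 => (Tr p.1 p.2 : ℂ)) 2 (P.prod surf)
        = eLpNorm (fun p : Ω × S2 => Tr p.1 p.2) 2 (P.prod surf) :=
      eLpNorm_congr_norm_ae (ae_of_all _ fun p => Complex.norm_real _)
    rw [h1] at h0
    have h2 := h0.trans_lt (ENNReal.mul_lt_top (tailBound_ne_top hY hT 0).lt_top
      (measure_lt_top _ _))
    by_contra h3
    rw [not_lt_top_iff] at h3
    rw [h3] at h2
    simp at h2
  · refine tendsto_zero_of_sq_le hprod ?_
    have := ENNReal.Tendsto.mul_const (tendsto_tailBound hY hT)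
      (Or.inr (measure_ne_top surf Set.univ))
    simpa using this
  · exact tendsto_zero_of_sq_le (fun N => hTrN N x) (tendsto_tailBound hY hT)

/-- Equality of laws passes to almost sure limits. -/
lemma identDistrib_of_ae_tendsto {E : Type*} [TopologicalSpace E] [MeasurableSpace E]
    [HasOuterApproxClosed E] [BorelSpace E] {P : Measure Ω} [IsProbabilityMeasure P]
    {X X' : ℕ → Ω → E} {Z Z' : Ω → E} (h : ∀ n, IdentDistrib (X n) (X' n) P P)
    (hZ : AEMeasurable Z P) (hZ' : AEMeasurable Z' P)
    (hX : ∀ᵐ ω ∂P, Tendsto (fun n => X n ω) atTop (𝓝 (Z ω)))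
    (hX' : ∀ᵐ ω ∂P, Tendsto (fun n => X' n ω) atTop (𝓝 (Z' ω))) : IdentDistrib Z Z' P P := by
  refine ⟨hZ, hZ', ?_⟩
  have := Measure.isProbabilityMeasure_map hZ
  have := Measure.isProbabilityMeasure_map hZ'
  refine ext_of_forall_integral_eq_of_IsFiniteMeasure fun f => ?_
  have hf := f.continuous.measurable
  rw [integral_map hZ hf.aestronglyMeasurable, integral_map hZ' hf.aestronglyMeasurable]
  have key : ∀ {X : ℕ → Ω → E} {Z : Ω → E}, (∀ n, AEMeasurable (X n) P) →
      (∀ᵐ ω ∂P, Tendsto (fun n => X n ω) atTop (𝓝 (Z ω))) →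
      Tendsto (fun n => ∫ ω, f (X n ω) ∂P) atTop (𝓝 (∫ ω, f (Z ω) ∂P)) := by
    intro X Z hXm hX
    refine tendsto_integral_of_dominated_convergence (fun _ => ‖f‖)
      (fun n => (hf.comp_aemeasurable (hXm n)).aestronglyMeasurable) (integrable_const _)
      (fun n => ae_of_all _ fun ω => f.norm_coe_le_norm _) ?_
    filter_upwards [hX] with ω hω
    exact (f.continuous.tendsto _).comp hω
  refine tendsto_nhds_unique (key (fun n => (h n).aemeasurable_fst) hX)
    ((key (fun n => (h n).aemeasurable_snd) hX').congr fun n => ?_)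
  exact ((h n).comp hf).integral_eq.symm

/-- At finitely many points, a regularized field is the almost sure limit of a subsequence of the
partial sums. -/
lemma IsRegularizedField.exists_seq_ae_tendsto {P : Measure Ω} [IsProbabilityMeasure P]
    {Y : ℕ → ℤ → S2 → ℂ} (hY : IsSphericalHarmonics Y) {β : ℕ → ℝ} {lam : ℝ} {T Tr : Ω → S2 → ℝ}
    (hT : IsRandomField P T) (hTr : IsRegularizedField P Y β lam T Tr) {κ : Type*} [Fintype κ]
    (z : κ → S2) : ∃ φ : ℕ → ℕ, ∀ᵐ ω ∂P, ∀ k,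
      Tendsto (fun n => regPartialSum Y β lam T (φ n) ω (z k)) atTop (𝓝 (Tr ω (z k))) := by
  -- A common subsequence is found from the sum `∑ k, d k N` of the distances at all the points.
  set d : κ → ℕ → Ω → ℝ := fun k N ω => ‖(Tr ω (z k) : ℂ) - regPartialSum Y β lam T N ω (z k)‖
    with hd
  have hdm : ∀ k N, AEStronglyMeasurable (d k N) P := fun k N =>
    ((Complex.measurable_ofReal.comp (hTr.isRandomField.measurable.comp
      measurable_prodMk_right)).sub
      (measurable_regPartialSum_apply hY β lam hT.measurable N (z k))).norm.aestronglyMeasurable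
  have hD : Tendsto (fun N => eLpNorm (∑ k, d k N) 2 P) atTop (𝓝 0) := by
    have h1 : Tendsto (fun N => ∑ k, eLpNorm (d k N) 2 P) atTop (𝓝 (∑ _k : κ, 0)) :=
      tendsto_finsetSum _ fun k _ => by
        simpa only [hd, eLpNorm_norm] using hTr.tendsto_at (z k)
    rw [Finset.sum_const_zero] at h1
    exact tendsto_of_tendsto_of_tendsto_of_le_of_le tendsto_const_nhds h1 (fun _ => zero_le)
      fun N => eLpNorm_sum_le (fun k _ => hdm k N) one_le_two
  have hmeasure : TendstoInMeasure P (fun N => ∑ k, d k N) atTop 0 :=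
    tendstoInMeasure_of_tendsto_eLpNorm two_ne_zero
      (fun N => Finset.aestronglyMeasurable_sum _ fun k _ => hdm k N)
      aestronglyMeasurable_zero (by simpa using hD)
  obtain ⟨φ, -, hφ⟩ := hmeasure.exists_seq_tendsto_ae
  refine ⟨φ, ?_⟩
  filter_upwards [hφ] with ω hω k
  rw [tendsto_iff_norm_sub_tendsto_zero]
  refine squeeze_zero (fun _ => norm_nonneg _) (fun n => ?_) hω
  rw [Finset.sum_apply, norm_sub_rev]
  exact Finset.single_le_sum (f := fun k => d k (φ n) ω) (fun k _ => norm_nonneg _)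
    (Finset.mem_univ k)

lemma IsRegularizedField.stronglyIsotropic {P : Measure Ω} [IsProbabilityMeasure P]
    {Y : ℕ → ℤ → S2 → ℂ} (hY : IsSphericalHarmonics Y) {β : ℕ → ℝ} {lam : ℝ} {T Tr : Ω → S2 → ℝ}
    (hT : IsRandomField P T) (hiso : StronglyIsotropic P T)
    (hTr : IsRegularizedField P Y β lam T Tr) : StronglyIsotropic P Tr := by
  intro k x ρ hρ
  obtain ⟨φ, hφ⟩ := hTr.exists_seq_ae_tendsto hY hT
    (Sum.elim x fun i => rotate ρ (x i) : Fin k ⊕ Fin k → S2)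
  have hm : ∀ z : Fin k → S2, Measurable fun ω i => Tr ω (z i) := fun z =>
    measurable_pi_lambda _ fun i =>
      hTr.isRandomField.measurable.comp measurable_prodMk_right
  refine identDistrib_of_ae_tendsto (fun n =>
    (identDistrib_regPartialSum hY β lam hT hiso hρ (fun _ : Fin k => φ n) x).comp
      (u := fun v i => (v i).re)
      (measurable_pi_lambda _ fun i => Complex.measurable_re.comp (measurable_pi_apply i)))
    (hm x).aemeasurable (hm _).aemeasurable ?_ ?_
  · filter_upwards [hφ] with ω hω
    rw [tendsto_pi_nhds]
    intro i
    exact (Complex.continuous_re.tendsto _).comp (hω (Sum.inl i))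
  · filter_upwards [hφ] with ω hω
    rw [tendsto_pi_nhds]
    intro i
    exact (Complex.continuous_re.tendsto _).comp (hω (Sum.inr i))

end

end SphereField

end

theorem theorem2 {Ω : Type*} [MeasurableSpace Ω] (P : MeasureTheory.Measure Ω)
    [MeasureTheory.IsProbabilityMeasure P]
    (Y : ℕ → ℤ → SphereField.S2 → ℂ) (hY : SphereField.IsSphericalHarmonics Y)
    (β : ℕ → ℝ) (hβ : ∀ ℓ, 0 < β ℓ) (lam : ℝ) (hlam : 0 ≤ lam)
    (To : Ω → SphereField.S2 → ℝ) (hTo : SphereField.IsRandomField P To)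
    (hiso : SphereField.StronglyIsotropic P To) :
    (∃ Tr : Ω → SphereField.S2 → ℝ, SphereField.IsRegularizedField P Y β lam To Tr) ∧
    ∀ Tr : Ω → SphereField.S2 → ℝ, SphereField.IsRegularizedField P Y β lam To Tr →
      SphereField.StronglyIsotropic P Tr :=
  ⟨SphereField.exists_isRegularizedField hY hβ hlam hTo hiso,
    fun _ hTr => hTr.stronglyIsotropic hY hTo hiso⟩
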